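/- Let $(\epsilon_t)_{t\in\mathbb Z}$ be a white noise: uncorrelated, identically distributed, $E\epsilon_t=0$, $E\epsilon_t^2=1$, and $E|\epsilon_t|^{4+\eta}<\infty$ for some $\eta>0$. Fix $\kappa\in(0,1)$, put $\Theta=\Gamma=[-1+\kappa,1-\kappa]$, let $\theta_0$ be a function with $\theta_0(u)\in\Theta$ for $u\in(0,1)$, twice differentiable on $(0,1)$ with uniformly bounded second derivative, and let $$Y_{t,T}=\epsilon_t+\theta_0(t/T)\,\epsilon_{t-1},\qquad t=0,1,\dots,T.$$ Let $\mathcal U_T=[\delta_T,1-\delta_T]$ with trimming constants $0<\delta_T<1/2$ (constant in $T$, or tending to $0$). Assume the following. (a) Mixing. The triangular array $(Y_{t,T},Y_{t-1,T})_{1\le t\le T}$ is $\phi$-mixing: its coefficients $$\phi(k)=\sup_{T}\sup_{1\le t\le T}\ \sup_{A,B}|P(B\mid A)-P(B)|,$$ where $A$, with $P(A)>0$, ranges over the $\sigma$-field generated by the pairs with time index in $[1,t]$ and $B$ over that generated by the pairs with time index in $[t+k,T]$, tend to $0$ as $k\to\infty$; and there are integers $1\le m_T\le T$ and $C<\infty$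 with $T\phi(m_T)/m_T\le C$ for all $T\ge1$. (b) Kernel. $K\ge 0$ is symmetric, bounded, Lipschitz, and $r$ times continuously differentiable for some $r\ge2$; $\int K=1$, $\int K^2<\infty$; either $K$ vanishes outside a bounded interval, or $|K'|\le C$ everywhere and, for some $v>1$ and $L>0$, $|K'(x)|\le C|x|^{-v}$ for $|x|>L$; $\int x^iK(x)\,dx=0$ for $1\le i\le r-1$, $\int x^rK(x)\,dx\ne0$, $\int|x|^rK(x)\,dx<\infty$; and $|x|K(x)\to0$ as $|x|\to\infty$. (c) Bandwidth. $h=h_T>0$, and as $T\to\infty$: $h\to0$, $Th\to\infty$, $Th/(m_T\log T)\to\infty$. (d) Auxiliary AR(1) model. Let $M_T[\rho;u]=\frac1{Th}\sum_{t=1}^T(Y_{t,T}-\rho Y_{t-1,T})^2K\big(\frac{u-t/T}{h}\big)$ and, for $u\in(0,1)$, let $\rho_0(u)\in\arg\min_{\rho\in\Gamma}\lim_{T\to\infty}E\,M_T[\rho;u]$. Then $\sup_{u\in(0,1)}|\rho_0(u)|<1$, and $\rho_0$ is twice differentiable on $(0,1)$ with uniformly bounded second derivative. (e) Bounded score. Write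 $q(y,z,\rho)=\partial_\rho(y-\rho z)^2$. There are $\varepsilon>0$, $c<\infty$ and random variables $R_{t,T}=O_p(T^{-1})$, uniformly in $1\le t\le T$, such that for all $1\le t\le T$, almost surely, $$\sup_{u\in\mathcal U_T}\ \sup_{\rho\in\Gamma,\,|\rho-\rho_0(u)|\le\varepsilon}|q(Y_{t,T},Y_{t-1,T},\rho)|\le c+R_{t,T}.$$ Let $$\hat\rho(u)=\frac{\sum_{t=1}^TY_{t-1,T}Y_{t,T}K\big(\frac{u-t/T}{h}\big)}{\sum_{t=1}^TY_{t-1,T}^2K\big(\frac{u-t/T}{h}\big)}.$$ For a fixed $H\ge1$ let $(\tilde\epsilon^{[j]}_t)_{t\in\mathbb Z}$, $j=1,\dots,H$, be independent simulated error processes, each with the law of the process $(\epsilon_t)$; put $\tilde y^{[j]}_{t}(\theta)=\tilde\epsilon^{[j]}_t+\theta\tilde\epsilon^{[j]}_{t-1}$ and $$\hat\rho(u;\theta)=\frac1H\sum_{j=1}^H\frac{\sum_{t=1}^T\tilde y^{[j]}_{t-1}(\theta)\,\tilde y^{[j]}_{t}(\theta)}{\sum_{t=1}^T\tilde y^{[j]}_{t-1}(\theta)^2}.$$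 Then any local indirect inference estimator $\hat\theta(u)\in\arg\max_{\theta\in\Theta}\,-|\hat\rho(u)-\hat\rho(u;\theta)|$ (a maximizer whenever one exists, arbitrary otherwise) satisfies, as $T\to\infty$, $$\sup_{u\in\mathcal U_T}|\hat\theta(u)-\theta_0(u)|=o_p(1).$$ -/

import Mathlib

open MeasureTheory ProbabilityTheory Filter Topology Set
open scoped ENNReal

noncomputable section

namespace LII

variable {Ω : Type*}

/-- `f` is twice differentiable on `s` with second derivative uniformly bounded on `s`.
It is used for open sets `s` only. -/
def BoundedSecondDeriv (f : ℝ → ℝ) (s : Set ℝ) : Prop :=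
  (∀ u ∈ s, DifferentiableAt ℝ f u ∧ DifferentiableAt ℝ (deriv f) u) ∧
    ∃ C : ℝ, ∀ u ∈ s, |deriv (deriv f) u| ≤ C

/-- The set of rescaled time points `[δ, 1 - δ]`. -/
def timeSet (δ : ℝ) : Set ℝ := Icc δ (1 - δ)

/-- The parameter space `[-1 + κ, 1 - κ]`, used both for the structural parameter (`Θ`)
and for the auxiliary parameter (`Γ`). -/
def paramSpace (κ : ℝ) : Set ℝ := Icc (-1 + κ) (1 - κ)

/-- A white noise with a common marginal distribution, mean zero, unit variance and a finite
absolute moment of some order larger than four. -/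
structure IsWhiteNoise [MeasurableSpace Ω] (μ : Measure Ω) (ε : ℤ → Ω → ℝ) : Prop where
  measurable : ∀ t, Measurable (ε t)
  identDistrib : ∀ t, IdentDistrib (ε t) (ε 0) μ μ
  mean_zero : ∀ t, ∫ ω, ε t ω ∂μ = 0
  unit_variance : ∀ t, ∫ ω, (ε t ω) ^ 2 ∂μ = 1
  uncorrelated : ∀ s t, s ≠ t → ∫ ω, ε s ω * ε t ω ∂μ = 0
  moment : ∃ η : ℝ, 0 < η ∧ ∀ t, Integrable (fun ω => |ε t ω| ^ (4 + η)) μ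

/-- The locally stationary MA(1) array `Y_{t,T} = ε_t + θ₀(t/T) ε_{t-1}`, first index `T`. -/
def obs (ε : ℤ → Ω → ℝ) (θ₀ : ℝ → ℝ) (T t : ℕ) (ω : Ω) : ℝ :=
  ε (t : ℤ) ω + θ₀ ((t : ℝ) / (T : ℝ)) * ε ((t : ℤ) - 1) ω

/-- The pair of observed variables `(Y_{t,T}, Z_{t,T})` with `Z_{t,T} = Y_{t-1,T}`,
for `t = 1, …, T`. -/
def obsPair (ε : ℤ → Ω → ℝ) (θ₀ : ℝ → ℝ) (T t : ℕ) (ω : Ω) : ℝ × ℝ :=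
  (obs ε θ₀ T t ω, obs ε θ₀ T (t - 1) ω)

/-- The σ-field generated by `X_{1,T}, …, X_{t,T}`. -/
abbrev pastField {E : Type*} [MeasurableSpace E] (X : ℕ → ℕ → Ω → E) (T t : ℕ) :
    MeasurableSpace Ω :=
  ⨆ i ∈ Finset.Icc 1 t, MeasurableSpace.comap (X T i) inferInstance

/-- The σ-field generated by `X_{s,T}, …, X_{T,T}` (trivial if `s > T`). -/
abbrev futureField {E : Type*} [MeasurableSpace E] (X : ℕ → ℕ → Ω → E) (T s : ℕ) :
    MeasurableSpace Ω :=
  ⨆ i ∈ Finset.Icc s T, MeasurableSpace.comap (X T i) inferInstance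

/-- The `φ`-mixing coefficient of order `k` of a triangular array `{X_{t,T} : 1 ≤ t ≤ T}`:
the supremum of `|P(B | A) - P(B)|` over all rows `T`, all `t ≤ T`, all events `A` of positive
probability in the past up to `t` and all events `B` in the future from `t + k` on. -/
def phiMix [MeasurableSpace Ω] {E : Type*} [MeasurableSpace E] (μ : Measure Ω)
    (X : ℕ → ℕ → Ω → E) (k : ℕ) : ℝ :=
  sSup {x : ℝ | ∃ T t : ℕ, 1 ≤ t ∧ t ≤ T ∧ ∃ A B : Set Ω,
    MeasurableSet[pastField X T t] A ∧ MeasurableSet[futureField X T (t + k)] B ∧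
    0 < μ.real A ∧ x = |μ.real (A ∩ B) / μ.real A - μ.real B|}

/-- The array is `φ`-mixing, with `T φ(m_T) / m_T` bounded, where `1 ≤ m_T ≤ T`. -/
structure IsPhiMixing [MeasurableSpace Ω] {E : Type*} [MeasurableSpace E] (μ : Measure Ω)
    (X : ℕ → ℕ → Ω → E) (m : ℕ → ℕ) : Prop where
  tendsto_zero : Tendsto (phiMix μ X) atTop (𝓝 0)
  one_le : ∀ T, 1 ≤ T → 1 ≤ m T
  le_self : ∀ T, 1 ≤ T → m T ≤ T
  rate : ∃ C : ℝ, ∀ T : ℕ, 1 ≤ T → (T : ℝ) * phiMix μ X (m T) / (m T : ℝ) ≤ C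

/-- The conditions on the kernel, of order `r`. -/
structure IsKernel (K : ℝ → ℝ) (r : ℕ) : Prop where
  nonneg : ∀ x, 0 ≤ K x
  symm : ∀ x, K (-x) = K x
  bounded : ∃ C : ℝ, ∀ x, K x ≤ C
  two_le : 2 ≤ r
  contDiff : ContDiff ℝ (r : ℕ∞) K
  integrable : Integrable K
  integral_eq_one : ∫ x, K x = 1
  integrable_sq : Integrable (fun x => K x ^ 2)
  tail : (∃ L : ℝ, 0 < L ∧ ∀ x, L < |x| → K x = 0) ∨
    (∃ C L v : ℝ, 0 < L ∧ 1 < v ∧ (∀ x, |deriv K x| ≤ C) ∧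
      ∀ x, L < |x| → |deriv K x| ≤ C * |x| ^ (-v))
  integrable_moment : Integrable (fun x => |x| ^ r * |K x|)
  moment_zero : ∀ i, 1 ≤ i → i < r → ∫ x, x ^ i * K x = 0
  moment_ne_zero : ∫ x, x ^ r * K x ≠ 0
  tendsto_zero : Tendsto (fun x => |x| * K x) (cocompact ℝ) (𝓝 0)
  lipschitz : ∃ C : ℝ, ∀ x x', |K x - K x'| ≤ C * |x - x'|

/-- The conditions on the bandwidth sequence. -/
structure IsBandwidth (h : ℕ → ℝ) (m : ℕ → ℕ) : Prop where
  pos : ∀ T, 0 < h T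
  tendsto_zero : Tendsto h atTop (𝓝 0)
  tendsto_mul : Tendsto (fun T : ℕ => (T : ℝ) * h T) atTop atTop
  tendsto_div : Tendsto (fun T : ℕ => (T : ℝ) * h T / ((m T : ℝ) * Real.log T)) atTop atTop

/-- The least squares loss `g` of the AR(1) auxiliary model. -/
def auxLoss (y z ρ : ℝ) : ℝ := (y - ρ * z) ^ 2

/-- The score `q = ∂g/∂ρ` of the auxiliary model. -/
def auxScore (y z ρ : ℝ) : ℝ := deriv (fun r => auxLoss y z r) ρ

/-- The local criterion `M_T[ρ; u]` for the array `Y` (first index `T`). -/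
def localCriterion (Y : ℕ → ℕ → Ω → ℝ) (K : ℝ → ℝ) (h : ℕ → ℝ) (T : ℕ) (ρ u : ℝ) (ω : Ω) : ℝ :=
  1 / ((T : ℝ) * h T) * ∑ t ∈ Finset.Icc 1 T,
    auxLoss (Y T t ω) (Y T (t - 1) ω) ρ * K ((u - (t : ℝ) / (T : ℝ)) / h T)

/-- `ρ₀` is the pseudo-true auxiliary function on `(0, 1)`: for each `u`, the limit
`M₀[ρ; u] = lim E M_T[ρ; u]` exists for `ρ ∈ Γ` and `ρ₀(u)` minimizes it over `Γ`. -/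
def IsPseudoTrue [MeasurableSpace Ω] (μ : Measure Ω) (Y : ℕ → ℕ → Ω → ℝ) (K : ℝ → ℝ)
    (h : ℕ → ℝ) (Γ : Set ℝ) (ρ₀ : ℝ → ℝ) : Prop :=
  ∀ u ∈ Ioo (0 : ℝ) 1, ∃ M₀ : ℝ → ℝ,
    (∀ ρ ∈ Γ, Tendsto (fun T => ∫ ω, localCriterion Y K h T ρ u ω ∂μ) atTop (𝓝 (M₀ ρ))) ∧
    ρ₀ u ∈ Γ ∧ IsMinOn M₀ Γ (ρ₀ u)

/-- The score of the auxiliary model, evaluated at the data, is bounded by a constant up to an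
`O_p(1/T)` term, uniformly over the rescaled times `u` and over a neighbourhood in `Γ` of the
pseudo-true value `ρ₀(u)`. -/
def ScoreBounded [MeasurableSpace Ω] (μ : Measure Ω) (Y : ℕ → ℕ → Ω → ℝ) (Γ : Set ℝ)
    (ρ₀ : ℝ → ℝ) (U : ℕ → Set ℝ) : Prop :=
  ∃ r : ℝ, 0 < r ∧ ∃ c : ℝ, ∃ R : ℕ → ℕ → Ω → ℝ,
    (∀ p : ℝ, 0 < p → ∃ M : ℝ, ∀ T t : ℕ, 1 ≤ t → t ≤ T →
      μ {ω | M < (T : ℝ) * |R T t ω|} ≤ ENNReal.ofReal p) ∧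
    ∀ T t : ℕ, 1 ≤ t → t ≤ T → ∀ᵐ ω ∂μ, ∀ u ∈ U T, ∀ ρ ∈ Γ, |ρ - ρ₀ u| ≤ r →
      |auxScore (Y T t ω) (Y T (t - 1) ω) ρ| ≤ c + R T t ω

/-- The kernel estimator `ρ̂(u)` of the auxiliary AR(1) parameter. -/
def rhoHat (Y : ℕ → ℕ → Ω → ℝ) (K : ℝ → ℝ) (h : ℕ → ℝ) (T : ℕ) (u : ℝ) (ω : Ω) : ℝ :=
  (∑ t ∈ Finset.Icc 1 T, Y T (t - 1) ω * Y T t ω * K ((u - (t : ℝ) / (T : ℝ)) / h T)) /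
    ∑ t ∈ Finset.Icc 1 T, (Y T (t - 1) ω) ^ 2 * K ((u - (t : ℝ) / (T : ℝ)) / h T)

/-- The simulated series `ỹ_t(θ) = ε̃_t + θ ε̃_{t-1}`. It depends on the rescaled time `u` only
through the value `θ` of the parameter, since the same simulated errors serve for all `u`. -/
def simObs (ε : ℤ → Ω → ℝ) (θ : ℝ) (t : ℕ) (ω : Ω) : ℝ :=
  ε (t : ℤ) ω + θ * ε ((t : ℤ) - 1) ω

/-- The AR(1) estimator computed from one simulated path of length `T`. -/
def rhoSimPath (ε : ℤ → Ω → ℝ) (T : ℕ) (θ : ℝ) (ω : Ω) : ℝ :=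
  (∑ t ∈ Finset.Icc 1 T, simObs ε θ (t - 1) ω * simObs ε θ t ω) /
    ∑ t ∈ Finset.Icc 1 T, (simObs ε θ (t - 1) ω) ^ 2

/-- The simulated auxiliary estimator `ρ̂(u; θ)`, averaged over the `H` simulated paths. -/
def rhoSim {H : ℕ} (εs : Fin H → ℤ → Ω → ℝ) (T : ℕ) (θ : ℝ) (ω : Ω) : ℝ :=
  1 / (H : ℝ) * ∑ j : Fin H, rhoSimPath (εs j) T θ ω

/-- `x ∈ S` maximizes `f` over `S`. -/
def IsArgmax (f : ℝ → ℝ) (S : Set ℝ) (x : ℝ) : Prop := x ∈ S ∧ IsMaxOn f S x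

/-- `θhat T u ω` is a version of the local indirect inference estimator: a maximizer over `Θ` of
`θ ↦ -|ρ̂(u) - ρ̂(u; θ)|`, whenever there is one. -/
def IsLIIEstimator {H : ℕ} (Y : ℕ → ℕ → Ω → ℝ) (K : ℝ → ℝ) (h : ℕ → ℝ)
    (εs : Fin H → ℤ → Ω → ℝ) (Θ : Set ℝ) (U : ℕ → Set ℝ) (θhat : ℕ → ℝ → Ω → ℝ) : Prop :=
  ∀ T : ℕ, ∀ u ∈ U T, ∀ ω : Ω,
    (∃ θ, IsArgmax (fun θ => -|rhoHat Y K h T u ω - rhoSim εs T θ ω|) Θ θ) →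
      IsArgmax (fun θ => -|rhoHat Y K h T u ω - rhoSim εs T θ ω|) Θ (θhat T u ω)

/-- `X_T = o_p(1)` for nonnegative extended real `X_T` (not assumed measurable: `μ` is then the
outer measure). -/
def IsLittleOpOne [MeasurableSpace Ω] (μ : Measure Ω) (X : ℕ → Ω → ℝ≥0∞) : Prop :=
  ∀ a : ℝ, 0 < a → Tendsto (fun T => μ {ω | ENNReal.ofReal a < X T ω}) atTop (𝓝 0)

end LII

end

/-! The proof compares both auxiliary estimators with the binding function `θ / (1 + θ²)`, the
lag-one autocorrelation of an MA(1) with unit error variance. For x, y in Θ, `binding x - binding y`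
equals (x - y)(1 - xy) / ((1 + x²)(1 + y²)). Since 1 - xy ≥ κ, the inverse is Lipschitz with
constant 4/κ (`abs_sub_le_binding`). If both estimators are uniformly within η of the binding
function, any maximizer is within 16η/κ of the truth (`abs_estimator_sub_le`).

The bounded score has a strong consequence: the errors are almost surely bounded
(`exists_noise_bound`). The score is affine in ρ with slope 2z², so a bound at two parameter values
bounds z² = Y_{t-1,T}². Each observation is therefore bounded by a fixed constant with probability
tending to one. Inverting the moving average with |θ₀| ≤ 1 - κ bounds ε_n up to (1 - κ)^n |ε_0|, and
the common marginal law makes the bound almost sure as n grows. From there on all variables are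
bounded.

Simulated side (`exists_rhoSim_close`): the estimator is a ratio of polynomials in θ whose
coefficients are averages of error products at lags at most 2, so finitely many weak laws give
uniformity in θ. White noise alone says nothing about correlations between such products. They
decorrelate because each error is, up to a geometrically small remainder, a function of finitely
many observations, and the observations are φ-mixing. The law of the errors transfers this to the
simulated paths.

Kernel side (`exists_rhoHat_close`): numerator minus `binding (θ₀ u)` times denominator splits into
two centred kernel sums and a deterministic bias. The centred sums are controlled by an exponential
inequality for φ-mixing blocks, a union bound over a grid and Lipschitz continuity of the kernel.
The bias is small because θ₀ is Lipschitz and the kernel decays. All sums are measured against the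
total kernel mass, which is of order at least Th up to the ends of the interval, so no boundary
correction is needed. -/

namespace LII

/-- One-sided `φ`-dependence of the σ-field `G` on the σ-field `F`. -/
def MixBound {Ω : Type*} {mΩ : MeasurableSpace Ω} (μ : Measure Ω) (F G : MeasurableSpace Ω)
    (φ : ℝ≥0∞) : Prop :=
  ∀ A B : Set Ω, MeasurableSet[F] A → MeasurableSet[G] B → μ (A ∩ B) ≤ μ A * μ B + φ * μ A

/-! ### Product, covariance and exponential moment inequalities under φ-mixing -/

section Mixing

variable {Ω : Type*} {F G : MeasurableSpace Ω} {mΩ : MeasurableSpace Ω} {μ : Measure Ω} {φ : ℝ≥0∞}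

/-- For fixed `B` the mixing inequality is a domination between two measures on `F`: restricting to
`B` costs at most the factor μ B + φ. Integrating `f` preserves it. -/
theorem MixBound.setLIntegral_le (hmix : MixBound μ F G φ) (hF : F ≤ mΩ)
    {f : Ω → ℝ≥0∞} (hf : Measurable[F] f) {B : Set Ω} (hB : MeasurableSet[G] B) :
    ∫⁻ ω in B, f ω ∂μ ≤ (μ B + φ) * ∫⁻ ω, f ω ∂μ := by
  have hle : (μ.restrict B).trim hF ≤ (μ B + φ) • μ.trim hF := by
    refine @Measure.le_intro Ω F _ _ fun A hA _ => ?_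
    rw [trim_measurableSet_eq hF hA, Measure.restrict_apply (hF A hA),
      Measure.smul_apply, trim_measurableSet_eq hF hA, smul_eq_mul, add_mul, mul_comm (μ B)]
    exact hmix A B hA hB
  calc ∫⁻ ω in B, f ω ∂μ = ∫⁻ ω, f ω ∂((μ.restrict B).trim hF) := (lintegral_trim hF hf).symm
    _ ≤ ∫⁻ ω, f ω ∂((μ B + φ) • μ.trim hF) := lintegral_mono' hle le_rfl
    _ = (μ B + φ) * ∫⁻ ω, f ω ∂μ := by
      rw [lintegral_smul_measure, lintegral_trim hF hf, smul_eq_mul]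

/-- Layer-cake formula for `g` under the measure with density `f`: each level set {g > t} is handled
by `MixBound.setLIntegral_le`. The error φ is paid only for levels 0 < t < b, which gives φ b. -/
theorem MixBound.lintegral_mul_le (hmix : MixBound μ F G φ) (hF : F ≤ mΩ) (hG : G ≤ mΩ)
    {f : Ω → ℝ≥0∞} (hf : Measurable[F] f) {g : Ω → ℝ} (hg : Measurable[G] g) {b : ℝ}
    (h0 : ∀ᵐ ω ∂μ, 0 ≤ g ω) (hb : ∀ᵐ ω ∂μ, g ω ≤ b) :
    ∫⁻ ω, f ω * ENNReal.ofReal (g ω) ∂μ ≤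
      (∫⁻ ω, f ω ∂μ) * (∫⁻ ω, ENNReal.ofReal (g ω) ∂μ + φ * ENNReal.ofReal b) := by
  have hf' : Measurable f := hf.mono hF le_rfl
  have hg' : Measurable g := hg.mono hG le_rfl
  set ν := μ.withDensity f with hν
  have hac : ν ≪ μ := withDensity_absolutelyContinuous μ f
  have e1 : ∫⁻ ω, f ω * ENNReal.ofReal (g ω) ∂μ = ∫⁻ ω, ENNReal.ofReal (g ω) ∂ν := by
    rw [hν, lintegral_withDensity_eq_lintegral_mul μ hf' hg'.ennreal_ofReal]
    rfl
  have hmeas : Measurable fun t : ℝ => μ {ω | t < g ω} :=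
    Antitone.measurable fun s t hst => measure_mono fun ω hω => lt_of_le_of_lt hst hω
  have hset : ∀ t : ℝ, MeasurableSet[G] {ω | t < g ω} := fun t => hg measurableSet_Ioi
  rw [e1, lintegral_eq_lintegral_meas_lt ν (hac h0) hg'.aemeasurable,
    lintegral_eq_lintegral_meas_lt μ h0 hg'.aemeasurable]
  calc ∫⁻ t in Ioi 0, ν {ω | t < g ω}
      ≤ ∫⁻ t in Ioi 0, (∫⁻ ω, f ω ∂μ) * (μ {ω | t < g ω} + (Iio b).indicator (fun _ => φ) t) := by
        refine lintegral_mono fun t => ?_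
        by_cases ht : t < b
        · rw [hν, withDensity_apply _ (hG _ (hset t)), mul_comm]
          simpa [indicator, ht] using hmix.setLIntegral_le hF hf (hset t)
        · have : μ {ω | t < g ω} = 0 := by
            refine measure_mono_null (fun ω hω => ?_) hb
            simp only [mem_ofPred_eq, mem_compl_iff, not_le] at hω ⊢
            exact lt_of_le_of_lt (not_lt.1 ht) hω
          rw [hac this]
          exact zero_le
    _ = (∫⁻ ω, f ω ∂μ) * ((∫⁻ t in Ioi 0, μ {ω | t < g ω}) + φ * ENNReal.ofReal b) := by
        have hm2 : Measurable fun t : ℝ => μ {ω | t < g ω} + (Iio b).indicator (fun _ => φ) t :=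
          hmeas.add (measurable_const.indicator measurableSet_Iio)
        rw [lintegral_const_mul _ hm2, lintegral_add_left hmeas, lintegral_indicator measurableSet_Iio,
          setLIntegral_const, Measure.restrict_apply measurableSet_Iio, Iio_inter_Ioi,
          Real.volume_Ioo, sub_zero]

theorem MixBound.mono {F' G' : MeasurableSpace Ω} (hmix : MixBound μ F G φ) (hF : F' ≤ F)
    (hG : G' ≤ G) : MixBound μ F' G' φ :=
  fun A B hA hB => hmix A B (hF A hA) (hG B hB)

theorem MixBound.of_bot_left [IsProbabilityMeasure μ] : MixBound μ ⊥ G φ := by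
  intro A B hA _
  rcases MeasurableSpace.measurableSet_bot_iff.1 hA with rfl | rfl <;> simp

theorem MixBound.of_bot_right [IsProbabilityMeasure μ] : MixBound μ F ⊥ φ := by
  intro A B _ hB
  rcases MeasurableSpace.measurableSet_bot_iff.1 hB with rfl | rfl <;> simp

/-- The supremum defining `phiMix` ranges over 1 ≤ t ≤ T only. Outside this range one of the two
σ-fields is trivial, so the bound holds for every `t`. -/
theorem mixBound_pastField_futureField [IsProbabilityMeasure μ] {E : Type*} [MeasurableSpace E]
    (X : ℕ → ℕ → Ω → E) (T t k : ℕ) :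
    MixBound μ (pastField X T t) (futureField X T (t + k)) (ENNReal.ofReal (phiMix μ X k)) := by
  rcases Nat.eq_zero_or_pos t with rfl | ht
  · have : pastField X T 0 = ⊥ := by simp [pastField]
    rw [this]
    exact MixBound.of_bot_left
  rcases lt_or_ge T t with htT | htT
  · have : futureField X T (t + k) = ⊥ := by
      simp [futureField, Finset.Icc_eq_empty_of_lt (show T < t + k by omega)]
    rw [this]
    exact MixBound.of_bot_right
  intro A B hA hB
  rcases eq_or_ne (μ A) 0 with h0 | h0
  · simp [measure_mono_null inter_subset_left h0, h0]
  have hpos : 0 < μ.real A := ENNReal.toReal_pos h0 (measure_ne_top μ A)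
  -- A real `sSup` dominates its elements only when the set is bounded above; here 1 is a bound.
  have hbdd : BddAbove {x : ℝ | ∃ T t : ℕ, 1 ≤ t ∧ t ≤ T ∧ ∃ A B : Set Ω,
      MeasurableSet[pastField X T t] A ∧ MeasurableSet[futureField X T (t + k)] B ∧
      0 < μ.real A ∧ x = |μ.real (A ∩ B) / μ.real A - μ.real B|} := by
    refine ⟨1, ?_⟩
    rintro x ⟨T, t, -, -, A, B, -, -, hA, rfl⟩
    have h1 : μ.real (A ∩ B) / μ.real A ≤ 1 :=
      (div_le_one hA).2 (measureReal_mono inter_subset_left)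
    have h2 : 0 ≤ μ.real (A ∩ B) / μ.real A := by positivity
    have h3 : μ.real B ≤ 1 := measureReal_le_one
    have h4 : 0 ≤ μ.real B := measureReal_nonneg
    rw [abs_le]
    constructor <;> linarith
  have hx : |μ.real (A ∩ B) / μ.real A - μ.real B| ≤ phiMix μ X k :=
    le_csSup hbdd ⟨T, t, ht, htT, A, B, hA, hB, hpos, rfl⟩
  have hφ : 0 ≤ phiMix μ X k := (abs_nonneg _).trans hx
  have h1 : μ.real (A ∩ B) ≤ μ.real A * μ.real B + phiMix μ X k * μ.real A := by
    have := (abs_le.1 hx).2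
    rw [sub_le_iff_le_add, div_le_iff₀ hpos] at this
    linarith
  have e : ∀ S : Set Ω, μ S = ENNReal.ofReal (μ.real S) := fun S =>
    (ENNReal.ofReal_toReal (measure_ne_top μ S)).symm
  rw [e (A ∩ B), e A, e B, ← ENNReal.ofReal_mul hpos.le, ← ENNReal.ofReal_mul hφ,
    ← ENNReal.ofReal_add (by positivity) (by positivity)]
  exact ENNReal.ofReal_le_ofReal h1

theorem phiMix_nonneg [IsProbabilityMeasure μ] {E : Type*} [MeasurableSpace E]
    (X : ℕ → ℕ → Ω → E) (k : ℕ) : 0 ≤ phiMix μ X k :=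
  Real.sSup_nonneg (by rintro x ⟨T, t, -, -, A, B, -, -, -, rfl⟩; exact abs_nonneg _)

/-- Covariance inequality for bounded variables. -/
theorem MixBound.integral_mul_le [IsProbabilityMeasure μ] {φ : ℝ} (hφ : 0 ≤ φ)
    (hmix : MixBound μ F G (ENNReal.ofReal φ)) (hF : F ≤ mΩ) (hG : G ≤ mΩ)
    {f g : Ω → ℝ} (hf : Measurable[F] f) (hg : Measurable[G] g) {a b : ℝ}
    (ha : ∀ᵐ ω ∂μ, |f ω| ≤ a) (hb : ∀ᵐ ω ∂μ, |g ω| ≤ b) :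
    ∫ ω, f ω * g ω ∂μ ≤ (∫ ω, f ω ∂μ) * (∫ ω, g ω ∂μ) + 4 * φ * a * b := by
  have hf' : Measurable f := hf.mono hF le_rfl
  have hg' : Measurable g := hg.mono hG le_rfl
  have hfi : Integrable f μ := Integrable.of_bound hf'.aestronglyMeasurable a ha
  have hgi : Integrable g μ := Integrable.of_bound hg'.aestronglyMeasurable b hb
  have hfgi : Integrable (fun ω => f ω * g ω) μ := by
    refine Integrable.of_bound (hf'.mul hg').aestronglyMeasurable (a * b) ?_
    filter_upwards [ha, hb] with ω h1 h2
    rw [norm_mul]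
    exact mul_le_mul h1 h2 (norm_nonneg _) ((abs_nonneg _).trans h1)
  obtain ⟨ω₀, ha₀, hb₀⟩ := (ha.and hb).exists
  have ha0 : 0 ≤ a := (abs_nonneg _).trans ha₀
  have hb0 : 0 ≤ b := (abs_nonneg _).trans hb₀
  -- Shifting by a and b makes both factors nonnegative, with g + b ≤ 2b. The error is then 2φb(E f
  -- + a) ≤ 4φab.
  have h1 := hmix.lintegral_mul_le hF hG (f := fun ω => ENNReal.ofReal (f ω + a))
    (Measurable.ennreal_ofReal (hf.add_const a)) (g := fun ω => g ω + b) (hg.add_const b)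
    (b := 2 * b)
    (by filter_upwards [hb] with ω h; linarith [(abs_le.1 h).1])
    (by filter_upwards [hb] with ω h; linarith [(abs_le.1 h).2])
  have hfa : 0 ≤ᵐ[μ] fun ω => f ω + a := by
    filter_upwards [ha] with ω h
    simp only [Pi.zero_apply]
    linarith [(abs_le.1 h).1]
  have hgb : 0 ≤ᵐ[μ] fun ω => g ω + b := by
    filter_upwards [hb] with ω h
    simp only [Pi.zero_apply]
    linarith [(abs_le.1 h).1]
  have hfai : Integrable (fun ω => f ω + a) μ := hfi.add (integrable_const a)
  have hgbi : Integrable (fun ω => g ω + b) μ := hgi.add (integrable_const b)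
  have hprod : Integrable (fun ω => (f ω + a) * (g ω + b)) μ := by
    have : (fun ω => (f ω + a) * (g ω + b)) =
        fun ω => f ω * g ω + b * f ω + a * g ω + a * b := by ext; ring
    rw [this]
    exact ((hfgi.add (hfi.const_mul b)).add (hgi.const_mul a)).add (integrable_const _)
  have hfm : 0 ≤ ∫ ω, f ω + a ∂μ := integral_nonneg_of_ae hfa
  have hgm : 0 ≤ ∫ ω, g ω + b ∂μ := integral_nonneg_of_ae hgb
  have e1 : ∫⁻ ω, ENNReal.ofReal (f ω + a) * ENNReal.ofReal (g ω + b) ∂μ =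
      ENNReal.ofReal (∫ ω, (f ω + a) * (g ω + b) ∂μ) := by
    rw [ofReal_integral_eq_lintegral_ofReal hprod]
    · refine lintegral_congr_ae ?_
      filter_upwards [hfa] with ω h
      rw [ENNReal.ofReal_mul h]
    · filter_upwards [hfa, hgb] with ω h h'
      exact mul_nonneg h h'
  rw [e1, ← ofReal_integral_eq_lintegral_ofReal hfai hfa,
    ← ofReal_integral_eq_lintegral_ofReal hgbi hgb, ← ENNReal.ofReal_mul hφ,
    ← ENNReal.ofReal_add hgm (by positivity), ← ENNReal.ofReal_mul hfm,
    ENNReal.ofReal_le_ofReal_iff (by positivity)] at h1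
  have e2 : ∫ ω, (f ω + a) * (g ω + b) ∂μ =
      ∫ ω, f ω * g ω ∂μ + b * ∫ ω, f ω ∂μ + a * ∫ ω, g ω ∂μ + a * b := by
    have : (fun ω => (f ω + a) * (g ω + b)) =
        fun ω => f ω * g ω + b * f ω + a * g ω + a * b := by ext; ring
    have i1 : Integrable (fun ω => f ω * g ω + b * f ω) μ := hfgi.add (hfi.const_mul b)
    have i2 : Integrable (fun ω => f ω * g ω + b * f ω + a * g ω) μ := i1.add (hgi.const_mul a)
    rw [this, integral_add i2 (integrable_const _), integral_add i1 (hgi.const_mul a),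
      integral_add hfgi (hfi.const_mul b), integral_const_mul, integral_const_mul]
    simp
  have e3 : ∫ ω, f ω + a ∂μ = ∫ ω, f ω ∂μ + a := by
    rw [integral_add hfi (integrable_const _)]; simp
  have e4 : ∫ ω, g ω + b ∂μ = ∫ ω, g ω ∂μ + b := by
    rw [integral_add hgi (integrable_const _)]; simp
  have hfle : ∫ ω, f ω ∂μ ≤ a := by
    calc ∫ ω, f ω ∂μ ≤ ∫ ω, a ∂μ := integral_mono_ae hfi (integrable_const a) (by
          filter_upwards [ha] with ω h
          exact (abs_le.1 h).2)
      _ = a := by simp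
  rw [e2, e3, e4] at h1
  nlinarith [mul_nonneg (mul_nonneg hφ hb0) (sub_nonneg.2 hfle)]

/-- Moment generating function of a sum of weakly dependent bounded blocks. -/
theorem lintegral_exp_sum_le [IsProbabilityMeasure μ] {φ : ℝ} (hφ : 0 ≤ φ)
    {B : ℕ → Ω → ℝ} {b : ℕ → ℝ} {F G : ℕ → MeasurableSpace Ω} (hF : ∀ n, F n ≤ mΩ)
    (hG : ∀ n, G n ≤ mΩ) (hBF : ∀ n, Measurable[F n] fun ω => ∑ i ∈ Finset.range n, B i ω)
    (hBG : ∀ n, Measurable[G n] (B n))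
    (hmix : ∀ n, MixBound μ (F n) (G n) (ENNReal.ofReal φ))
    (hb : ∀ n, ∀ᵐ ω ∂μ, |B n ω| ≤ b n) (hmean : ∀ n, ∫ ω, B n ω ∂μ = 0)
    {l : ℝ} (hl : 0 ≤ l) (hlb : ∀ n, l * b n ≤ 1) (n : ℕ) :
    ∫⁻ ω, ENNReal.ofReal (Real.exp (l * ∑ i ∈ Finset.range n, B i ω)) ∂μ ≤
      ENNReal.ofReal (Real.exp (∑ i ∈ Finset.range n, (l ^ 2 * b i ^ 2 + 3 * φ))) := by
  induction n with
  | zero => simp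
  | succ n ih =>
    have hBm : Measurable (B n) := (hBG n).mono (hG n) le_rfl
    have hlB : ∀ᵐ ω ∂μ, |l * B n ω| ≤ 1 := by
      filter_upwards [hb n] with ω h
      rw [abs_mul, abs_of_nonneg hl]
      exact (mul_le_mul_of_nonneg_left h hl).trans (hlb n)
    have hBi : Integrable (B n) μ := Integrable.of_bound hBm.aestronglyMeasurable (b n) (hb n)
    have hbn : 0 ≤ b n := by
      obtain ⟨ω, hω⟩ := (hb n).exists
      exact (abs_nonneg _).trans hω
    have hone : ∫⁻ ω, ENNReal.ofReal (Real.exp (l * B n ω)) ∂μ ≤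
        ENNReal.ofReal (1 + l ^ 2 * b n ^ 2) := by
      calc ∫⁻ ω, ENNReal.ofReal (Real.exp (l * B n ω)) ∂μ
          ≤ ∫⁻ ω, ENNReal.ofReal (1 + l ^ 2 * b n ^ 2 + l * B n ω) ∂μ := by
            refine lintegral_mono_ae ?_
            filter_upwards [hlB, hb n] with ω h h'
            refine ENNReal.ofReal_le_ofReal ?_
            -- This is exp x ≤ 1 + x + x² for |x| ≤ 1; the linear term vanishes after integration
            -- because the block is centred.
            have h1 := (abs_le.1 (Real.abs_exp_sub_one_sub_id_le h)).2
            have h2 : B n ω ^ 2 ≤ b n ^ 2 := sq_le_sq' (abs_le.1 h').1 (abs_le.1 h').2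
            have h3 := mul_le_mul_of_nonneg_left h2 (sq_nonneg l)
            rw [mul_pow] at h1
            linarith
        _ = ENNReal.ofReal (∫ ω, (1 + l ^ 2 * b n ^ 2 + l * B n ω) ∂μ) := by
            have hi : Integrable (fun ω => 1 + l ^ 2 * b n ^ 2 + l * B n ω) μ :=
              (integrable_const _).add (hBi.const_mul l)
            rw [ofReal_integral_eq_lintegral_ofReal hi]
            filter_upwards [hlB] with ω h
            simp only [Pi.zero_apply]
            nlinarith [(abs_le.1 h).1, mul_nonneg (sq_nonneg l) (sq_nonneg (b n))]
        _ = ENNReal.ofReal (1 + l ^ 2 * b n ^ 2) := by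
            rw [integral_add (integrable_const _) (hBi.const_mul l), integral_const_mul, hmean n]
            simp
    -- The new block is split off from the previous ones. Its exponential is at most e ≤ 3, whence
    -- the 3φ per block.
    have hstep := (hmix n).lintegral_mul_le (hF n) (hG n)
      (f := fun ω => ENNReal.ofReal (Real.exp (l * ∑ i ∈ Finset.range n, B i ω)))
      (Measurable.ennreal_ofReal (Real.measurable_exp.comp ((hBF n).const_mul l)))
      (g := fun ω => Real.exp (l * B n ω)) (Real.measurable_exp.comp ((hBG n).const_mul l))
      (b := 3) (ae_of_all _ fun ω => (Real.exp_pos _).le)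
      (by
        filter_upwards [hlB] with ω h
        have := Real.exp_le_exp.2 (abs_le.1 h).2
        linarith [Real.exp_one_lt_d9])
    calc ∫⁻ ω, ENNReal.ofReal (Real.exp (l * ∑ i ∈ Finset.range (n + 1), B i ω)) ∂μ
        = ∫⁻ ω, ENNReal.ofReal (Real.exp (l * ∑ i ∈ Finset.range n, B i ω)) *
            ENNReal.ofReal (Real.exp (l * B n ω)) ∂μ := by
          refine lintegral_congr fun ω => ?_
          rw [Finset.sum_range_succ, mul_add, Real.exp_add, ENNReal.ofReal_mul (Real.exp_pos _).le]
      _ ≤ _ := hstep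
      _ ≤ ENNReal.ofReal (Real.exp (∑ i ∈ Finset.range n, (l ^ 2 * b i ^ 2 + 3 * φ))) *
            (ENNReal.ofReal (1 + l ^ 2 * b n ^ 2) + ENNReal.ofReal φ * ENNReal.ofReal 3) := by
          gcongr
      _ ≤ ENNReal.ofReal
            (Real.exp (∑ i ∈ Finset.range (n + 1), (l ^ 2 * b i ^ 2 + 3 * φ))) := by
          rw [← ENNReal.ofReal_mul hφ, ← ENNReal.ofReal_add (by positivity) (by positivity),
            ← ENNReal.ofReal_mul (Real.exp_pos _).le, Finset.sum_range_succ, Real.exp_add]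
          refine ENNReal.ofReal_le_ofReal (mul_le_mul_of_nonneg_left ?_ (Real.exp_pos _).le)
          linarith [Real.add_one_le_exp (l ^ 2 * b n ^ 2 + 3 * φ)]

end Mixing

/-! ### Blocking by parity and an exponential inequality for weighted sums -/

section Blocks

theorem sum_range_two_mul_eq (c : ℕ → ℝ) (N : ℕ) :
    ∑ j ∈ Finset.range (2 * N), c j =
      ∑ n ∈ Finset.range N, c (2 * n + 0) + ∑ n ∈ Finset.range N, c (2 * n + 1) := by
  induction N with
  | zero => simp
  | succ N ih =>
    rw [show 2 * (N + 1) = 2 * N + 1 + 1 by ring, Finset.sum_range_succ, Finset.sum_range_succ, ih,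
      Finset.sum_range_succ, Finset.sum_range_succ]
    simp only [add_zero]
    ring

/-- The sum of `g` over the `j`-th block of length `m` in `{1, …, T}`. -/
def blockSum (T m : ℕ) (g : ℕ → ℝ) (j : ℕ) : ℝ :=
  ∑ t ∈ (Finset.Icc 1 T).filter (fun t => (t - 1) / m = j), g t

/-- Even and odd blocks are separated so that two consecutive blocks of one parity are a whole block
apart. The number T / m + 1 of pairs is generous; surplus blocks are empty. -/
theorem sum_eq_blockSum (T m : ℕ) (g : ℕ → ℝ) :
    ∑ t ∈ Finset.Icc 1 T, g t =
      ∑ n ∈ Finset.range (T / m + 1), blockSum T m g (2 * n + 0) +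
        ∑ n ∈ Finset.range (T / m + 1), blockSum T m g (2 * n + 1) := by
  rw [← sum_range_two_mul_eq]
  refine (Finset.sum_fiberwise_of_maps_to (fun t ht => ?_) g).symm
  have h1 : (t - 1) / m ≤ T / m :=
    Nat.div_le_div_right ((Nat.sub_le t 1).trans (Finset.mem_Icc.1 ht).2)
  exact Finset.mem_range.2 (by omega)

theorem blockSum_mem {T m t j : ℕ} (hm : 1 ≤ m)
    (ht : t ∈ (Finset.Icc 1 T).filter (fun t => (t - 1) / m = j)) :
    t ∈ Finset.Icc 1 T ∧ j * m + 1 ≤ t ∧ t ≤ (j + 1) * m := by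
  obtain ⟨h1, h2⟩ := Finset.mem_filter.1 ht
  have h3 := (Nat.div_eq_iff hm).1 h2
  have h4 := (Finset.mem_Icc.1 h1).1
  refine ⟨h1, by omega, ?_⟩
  rw [Nat.succ_mul]
  omega

theorem blockSum_nonneg {T m : ℕ} {v : ℕ → ℝ} (hv : ∀ t, 0 ≤ v t) (j : ℕ) :
    0 ≤ blockSum T m v j :=
  Finset.sum_nonneg fun t _ => hv t

theorem blockSum_le {T m : ℕ} (hm : 1 ≤ m) {v : ℕ → ℝ} {β : ℝ} (hβ : 0 ≤ β)
    (hvβ : ∀ t ∈ Finset.Icc 1 T, (m : ℝ) * v t ≤ β) (j : ℕ) : blockSum T m v j ≤ β := by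
  have hm0 : (0 : ℝ) < m := by exact_mod_cast hm
  set S := (Finset.Icc 1 T).filter (fun t => (t - 1) / m = j)
  have hcard : S.card ≤ m := by
    have : S ⊆ Finset.Icc (j * m + 1) (j * m + m) := fun t ht => by
      have := blockSum_mem hm ht
      rw [Nat.succ_mul] at this
      exact Finset.mem_Icc.2 this.2
    refine (Finset.card_le_card this).trans ?_
    rw [Nat.card_Icc]
    omega
  calc blockSum T m v j ≤ ∑ t ∈ S, β / m := Finset.sum_le_sum fun t ht => by
        rw [le_div_iff₀ hm0, mul_comm]
        exact hvβ t (blockSum_mem hm ht).1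
    _ = S.card * (β / m) := by simp
    _ ≤ m * (β / m) := by gcongr
    _ = β := by field_simp

variable {Ω : Type*} {mΩ : MeasurableSpace Ω} {μ : Measure Ω} {E : Type*} [MeasurableSpace E]

theorem pastField_le {X : ℕ → ℕ → Ω → E} (hX : ∀ T t, Measurable (X T t)) (T t : ℕ) :
    pastField X T t ≤ mΩ :=
  iSup₂_le fun i _ => (hX T i).comap_le

theorem futureField_le {X : ℕ → ℕ → Ω → E} (hX : ∀ T t, Measurable (X T t)) (T t : ℕ) :
    futureField X T t ≤ mΩ :=
  iSup₂_le fun i _ => (hX T i).comap_le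

theorem measurable_pastField (X : ℕ → ℕ → Ω → E) {T t i : ℕ} (hi : 1 ≤ i) (hit : i ≤ t) :
    Measurable[pastField X T t] (X T i) :=
  (comap_measurable (X T i)).mono
    (le_iSup₂ (f := fun i (_ : i ∈ Finset.Icc 1 t) => MeasurableSpace.comap (X T i) inferInstance)
      i (Finset.mem_Icc.2 ⟨hi, hit⟩)) le_rfl

theorem measurable_futureField (X : ℕ → ℕ → Ω → E) {T s i : ℕ} (hi : s ≤ i) (hiT : i ≤ T) :
    Measurable[futureField X T s] (X T i) :=
  (comap_measurable (X T i)).mono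
    (le_iSup₂ (f := fun i (_ : i ∈ Finset.Icc s T) => MeasurableSpace.comap (X T i) inferInstance)
      i (Finset.mem_Icc.2 ⟨hi, hiT⟩)) le_rfl

theorem futureField_anti (X : ℕ → ℕ → Ω → E) {T s s' : ℕ} (hs : s ≤ s') :
    futureField X T s' ≤ futureField X T s :=
  iSup₂_le fun _ hi => (measurable_futureField X (hs.trans (Finset.mem_Icc.1 hi).1)
    (Finset.mem_Icc.1 hi).2).comap_le

variable [IsProbabilityMeasure μ]

/-- Block q starts at time qm + 1, and the previous block of the same parity ends at (q - 1)m. For q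
= 0 the truncated subtraction gives an empty past. -/
theorem mixBound_blocks (X : ℕ → ℕ → Ω → E) (T m q : ℕ) :
    MixBound μ (pastField X T ((q - 1) * m)) (futureField X T (q * m + 1))
      (ENNReal.ofReal (phiMix μ X m)) := by
  rcases Nat.eq_zero_or_pos q with rfl | hq
  · have : pastField X T ((0 - 1) * m) = ⊥ := by simp [pastField]
    rw [this]
    exact MixBound.of_bot_left
  · refine (mixBound_pastField_futureField X T ((q - 1) * m) m).mono le_rfl
      (futureField_anti X ?_)
    obtain ⟨q, rfl⟩ := Nat.exists_eq_add_of_le' hq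
    rw [Nat.add_sub_cancel, Nat.succ_mul]
    omega

/-- Exponential bound for the blocks of one parity `p`. -/
theorem measure_parity_sum_gt_le {X : ℕ → ℕ → Ω → E} (hX : ∀ T t, Measurable (X T t))
    {T m : ℕ} (hm : 1 ≤ m) {f : ℕ → E → ℝ} (hf : ∀ t, Measurable (f t)) {v : ℕ → ℝ}
    (hv : ∀ t, 0 ≤ v t) (hsum : ∑ t ∈ Finset.Icc 1 T, v t ≤ 1) {β : ℝ} (hβ : 0 < β)
    (hvβ : ∀ t ∈ Finset.Icc 1 T, (m : ℝ) * v t ≤ β)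
    (hb : ∀ᵐ ω ∂μ, ∀ t ∈ Finset.Icc 1 T, |f t (X T t ω)| ≤ 1)
    (hmean : ∀ t ∈ Finset.Icc 1 T, ∫ ω, f t (X T t ω) ∂μ = 0)
    {a : ℝ} (ha : 0 < a) (ha1 : a ≤ 1) {p : ℕ} (hp : p = 0 ∨ p = 1) :
    μ {ω | a / 2 < ∑ n ∈ Finset.range (T / m + 1),
        blockSum T m (fun t => v t * f t (X T t ω)) (2 * n + p)} ≤
      ENNReal.ofReal (Real.exp (-a ^ 2 / (16 * β) + 3 * phiMix μ X m * (T / m + 1 : ℕ))) := by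
  set φ := phiMix μ X m
  have hφ : 0 ≤ φ := phiMix_nonneg X m
  set B : ℕ → Ω → ℝ := fun n ω => blockSum T m (fun t => v t * f t (X T t ω)) (2 * n + p) with hB
  set b : ℕ → ℝ := fun n => blockSum T m v (2 * n + p)
  -- Minimizes the Chernoff exponent -l a / 2 + l² β, with value -a² / (16β).
  set l : ℝ := a / (4 * β)
  have hl : 0 ≤ l := by positivity
  have hbβ : ∀ n, b n ≤ β := fun n => blockSum_le hm hβ.le hvβ _
  have hb0 : ∀ n, 0 ≤ b n := fun n => blockSum_nonneg hv _
  have hint : ∀ t ∈ Finset.Icc 1 T, Integrable (fun ω => f t (X T t ω)) μ := fun t ht => by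
    refine Integrable.of_bound ((hf t).comp (hX T t)).aestronglyMeasurable 1 ?_
    filter_upwards [hb] with ω h
    exact h t ht
  have hmgf := lintegral_exp_sum_le (μ := μ) hφ (B := B) (b := b)
    (F := fun n => pastField X T ((2 * n + p - 1) * m))
    (G := fun n => futureField X T ((2 * n + p) * m + 1))
    (fun n => pastField_le hX T _) (fun n => futureField_le hX T _)
    (fun n => by
      refine Finset.measurable_sum _ fun i hi => Finset.measurable_sum _ fun t ht => ?_
      have h1 := blockSum_mem hm ht
      have h2 := Finset.mem_range.1 hi
      refine Measurable.const_mul ((hf t).comp (measurable_pastField X (by omega) ?_)) _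
      exact h1.2.2.trans (Nat.mul_le_mul_right m (by omega)))
    (fun n => by
      refine Finset.measurable_sum _ fun t ht => ?_
      have h1 := blockSum_mem hm ht
      exact Measurable.const_mul ((hf t).comp
        (measurable_futureField X h1.2.1 (Finset.mem_Icc.1 h1.1).2)) _)
    (fun n => mixBound_blocks X T m _)
    (fun n => by
      filter_upwards [hb] with ω h
      refine (Finset.abs_sum_le_sum_abs _ _).trans (Finset.sum_le_sum fun t ht => ?_)
      rw [abs_mul, abs_of_nonneg (hv t)]
      exact mul_le_of_le_one_right (hv t) (h t (blockSum_mem hm ht).1))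
    (fun n => by
      simp only [hB, blockSum]
      rw [integral_finsetSum _ fun t ht => (hint t (blockSum_mem hm ht).1).const_mul _]
      refine Finset.sum_eq_zero fun t ht => ?_
      rw [integral_const_mul, hmean t (blockSum_mem hm ht).1, mul_zero])
    hl (fun n => by
      calc l * b n ≤ l * β := by gcongr; exact hbβ n
        _ = a / 4 := by simp only [l]; field_simp
        _ ≤ 1 := by linarith) (T / m + 1)
  have hbsum : ∑ n ∈ Finset.range (T / m + 1), b n ≤ 1 := by
    have h1 := sum_eq_blockSum T m v
    have h2 : 0 ≤ ∑ n ∈ Finset.range (T / m + 1), blockSum T m v (2 * n + 0) :=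
      Finset.sum_nonneg fun n _ => blockSum_nonneg hv _
    have h3 : 0 ≤ ∑ n ∈ Finset.range (T / m + 1), blockSum T m v (2 * n + 1) :=
      Finset.sum_nonneg fun n _ => blockSum_nonneg hv _
    rcases hp with rfl | rfl
    · change ∑ n ∈ Finset.range (T / m + 1), blockSum T m v (2 * n + 0) ≤ 1
      linarith
    · change ∑ n ∈ Finset.range (T / m + 1), blockSum T m v (2 * n + 1) ≤ 1
      linarith
  have hexp : ∑ i ∈ Finset.range (T / m + 1), (l ^ 2 * b i ^ 2 + 3 * φ) ≤
      l ^ 2 * β + 3 * φ * (T / m + 1 : ℕ) := by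
    rw [Finset.sum_add_distrib, ← Finset.mul_sum]
    -- The variance proxy: each block carries weight at most β, and the total weight is at most 1.
    have h1 : ∑ i ∈ Finset.range (T / m + 1), b i ^ 2 ≤ β := by
      calc ∑ i ∈ Finset.range (T / m + 1), b i ^ 2
          ≤ ∑ i ∈ Finset.range (T / m + 1), β * b i := Finset.sum_le_sum fun i _ => by
            rw [sq]
            exact mul_le_mul_of_nonneg_right (hbβ i) (hb0 i)
        _ = β * ∑ i ∈ Finset.range (T / m + 1), b i := by rw [Finset.mul_sum]
        _ ≤ β := mul_le_of_le_one_right hβ.le hbsum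
    have h2 : ∑ _i ∈ Finset.range (T / m + 1), 3 * φ = 3 * φ * (T / m + 1 : ℕ) := by
      rw [Finset.sum_const, Finset.card_range, nsmul_eq_mul, mul_comm]
    rw [h2]
    gcongr
  set S : Ω → ℝ := fun ω => ∑ n ∈ Finset.range (T / m + 1), B n ω
  set c := ENNReal.ofReal (Real.exp (-(l * (a / 2))))
  calc μ {ω | a / 2 < S ω}
      ≤ ∫⁻ ω, c * ENNReal.ofReal (Real.exp (l * S ω)) ∂μ := by
        refine meas_le_lintegral₀ ?_ fun ω hω => ?_
        · have hSm : Measurable S := by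
            refine Finset.measurable_sum _ fun n _ => Finset.measurable_sum _ fun t _ => ?_
            exact Measurable.const_mul ((hf t).comp (hX T t)) _
          exact (Measurable.const_mul
            (Measurable.ennreal_ofReal (Real.measurable_exp.comp (hSm.const_mul l))) _).aemeasurable
        · rw [← ENNReal.ofReal_mul (Real.exp_pos _).le, ← Real.exp_add, ENNReal.one_le_ofReal,
            Real.one_le_exp_iff]
          have : a / 2 < S ω := hω
          nlinarith
    _ = c * ∫⁻ ω, ENNReal.ofReal (Real.exp (l * S ω)) ∂μ :=
        lintegral_const_mul' _ _ ENNReal.ofReal_ne_top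
    _ ≤ c * ENNReal.ofReal (Real.exp (l ^ 2 * β + 3 * φ * (T / m + 1 : ℕ))) := by
        gcongr
        exact hmgf.trans (ENNReal.ofReal_le_ofReal (Real.exp_le_exp.2 hexp))
    _ = ENNReal.ofReal (Real.exp (-a ^ 2 / (16 * β) + 3 * φ * (T / m + 1 : ℕ))) := by
        rw [← ENNReal.ofReal_mul (Real.exp_pos _).le, ← Real.exp_add]
        congr 2
        simp only [l]
        field_simp
        ring

/-- Exponential inequality for weighted sums of bounded `φ`-mixing variables. -/
theorem measure_abs_weighted_sum_gt_le {X : ℕ → ℕ → Ω → E} (hX : ∀ T t, Measurable (X T t))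
    {T m : ℕ} (hm : 1 ≤ m) {f : ℕ → E → ℝ} (hf : ∀ t, Measurable (f t)) {v : ℕ → ℝ}
    (hv : ∀ t, 0 ≤ v t) (hsum : ∑ t ∈ Finset.Icc 1 T, v t ≤ 1) {β : ℝ} (hβ : 0 < β)
    (hvβ : ∀ t ∈ Finset.Icc 1 T, (m : ℝ) * v t ≤ β)
    (hb : ∀ᵐ ω ∂μ, ∀ t ∈ Finset.Icc 1 T, |f t (X T t ω)| ≤ 1)
    (hmean : ∀ t ∈ Finset.Icc 1 T, ∫ ω, f t (X T t ω) ∂μ = 0)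
    {a : ℝ} (ha : 0 < a) (ha1 : a ≤ 1) :
    μ {ω | a < |∑ t ∈ Finset.Icc 1 T, v t * f t (X T t ω)|} ≤
      4 * ENNReal.ofReal
        (Real.exp (-a ^ 2 / (16 * β) + 3 * phiMix μ X m * (T / m + 1 : ℕ))) := by
  set e := ENNReal.ofReal (Real.exp (-a ^ 2 / (16 * β) + 3 * phiMix μ X m * (T / m + 1 : ℕ)))
  have key : ∀ g : ℕ → E → ℝ, (∀ t, Measurable (g t)) →
      (∀ᵐ ω ∂μ, ∀ t ∈ Finset.Icc 1 T, |g t (X T t ω)| ≤ 1) →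
      (∀ t ∈ Finset.Icc 1 T, ∫ ω, g t (X T t ω) ∂μ = 0) →
      μ {ω | a < ∑ t ∈ Finset.Icc 1 T, v t * g t (X T t ω)} ≤ e + e := by
    intro g hg hgb hgm
    -- If the whole sum exceeds a, one of the two parities exceeds a / 2. Two parities and two signs
    -- give the factor 4.
    refine le_trans (measure_mono fun ω hω => ?_) ((measure_union_le _ _).trans (add_le_add
      (measure_parity_sum_gt_le hX hm hg hv hsum hβ hvβ hgb hgm ha ha1 (Or.inl rfl))
      (measure_parity_sum_gt_le hX hm hg hv hsum hβ hvβ hgb hgm ha ha1 (Or.inr rfl))))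
    by_contra hcon
    simp only [mem_union, mem_ofPred_eq, not_or, not_lt] at hcon hω
    rw [sum_eq_blockSum T m] at hω
    linarith [hcon.1, hcon.2]
  have h1 := key f hf hb hmean
  have h2 := key (fun t x => -f t x) (fun t => (hf t).neg)
    (by filter_upwards [hb] with ω h t ht; rw [abs_neg]; exact h t ht)
    (fun t ht => by rw [integral_neg, hmean t ht, neg_zero])
  have : {ω | a < |∑ t ∈ Finset.Icc 1 T, v t * f t (X T t ω)|} ⊆
      {ω | a < ∑ t ∈ Finset.Icc 1 T, v t * f t (X T t ω)} ∪
      {ω | a < ∑ t ∈ Finset.Icc 1 T, v t * -f t (X T t ω)} := by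
    intro ω hω
    simp only [mem_ofPred_eq, mem_union, mul_neg, Finset.sum_neg_distrib] at hω ⊢
    exact lt_abs.1 hω
  calc _ ≤ _ := measure_mono this
    _ ≤ _ := measure_union_le _ _
    _ ≤ (e + e) + (e + e) := add_le_add h1 h2
    _ = 4 * e := by ring

end Blocks

/-! ### Almost sure boundedness of the errors from the bounded score -/

section BoundedNoise

theorem auxScore_eq (y z ρ : ℝ) : auxScore y z ρ = -2 * z * (y - ρ * z) := by
  have h : HasDerivAt (fun r => (y - r * z) ^ 2) (2 * (y - ρ * z) ^ 1 * (0 - 1 * z)) ρ :=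
    (((hasDerivAt_const ρ y).sub ((hasDerivAt_id ρ).mul_const z)).pow 2)
  simp only [auxScore, auxLoss]
  rw [h.deriv]
  ring

/-- If the score is bounded over a nondegenerate parameter range, so is the regressor. -/
theorem sq_le_of_auxScore {κ r ρ₀ y z c : ℝ} (hκ₁ : κ < 1) (hr : 0 < r)
    (hρ₀ : ρ₀ ∈ paramSpace κ)
    (hs : ∀ ρ ∈ paramSpace κ, |ρ - ρ₀| ≤ r → |auxScore y z ρ| ≤ c) :
    z ^ 2 ≤ c / min r (1 - κ) := by
  set s := min r (1 - κ)
  have hs0 : 0 < s := lt_min hr (by linarith)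
  have hsr : s ≤ r := min_le_left _ _
  have hsκ : s ≤ 1 - κ := min_le_right _ _
  have h1 := hs ρ₀ hρ₀ (by simpa using hr.le)
  rw [le_div_iff₀ hs0]
  rw [auxScore_eq, abs_le] at h1
  obtain ⟨hl, hu⟩ := hρ₀
  -- Moving from `ρ₀` towards or past 0 by s ≤ 1 - κ stays in the parameter set. The score changes
  -- by 2 s z² in absolute value, and both values are at most c.
  rcases le_total ρ₀ 0 with h0 | h0
  · have h2 := hs (ρ₀ + s) ⟨by linarith, by linarith⟩ (by
      rw [add_sub_cancel_left, abs_of_pos hs0]; exact hsr)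
    rw [auxScore_eq, abs_le] at h2
    nlinarith
  · have h2 := hs (ρ₀ - s) ⟨by linarith, by linarith⟩ (by
      rw [sub_sub_cancel_left, abs_neg, abs_of_pos hs0]; exact hsr)
    rw [auxScore_eq, abs_le] at h2
    nlinarith

variable {Ω : Type*} {ε : ℤ → Ω → ℝ} {κ : ℝ} {θ₀ : ℝ → ℝ}

theorem abs_le_of_mem_paramSpace {x : ℝ} (hx : x ∈ paramSpace κ) : |x| ≤ 1 - κ :=
  abs_le.2 ⟨by linarith [hx.1], hx.2⟩

theorem div_mem_Ioo {t T : ℕ} (ht : 1 ≤ t) (htT : t < T) : (t : ℝ) / T ∈ Ioo (0 : ℝ) 1 := by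
  have h1 : (0 : ℝ) < t := by exact_mod_cast ht
  have h2 : (t : ℝ) < T := by exact_mod_cast htT
  exact ⟨div_pos h1 (h1.trans h2), (div_lt_one (h1.trans h2)).2 h2⟩

/-- Inversion of the moving average: bounded observations give bounded errors, up to a
geometrically small contribution of the initial error. -/
theorem abs_noise_le (hκ₀ : 0 < κ) (hκ₁ : κ < 1)
    (hθ₀mem : ∀ u ∈ Ioo (0 : ℝ) 1, θ₀ u ∈ paramSpace κ) {T : ℕ} {ω : Ω} {B : ℝ} (n : ℕ)
    (hn : n < T) (hB : ∀ i : ℕ, 1 ≤ i → i ≤ n → |obs ε θ₀ T i ω| ≤ B) (hB0 : 0 ≤ B) :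
    |ε n ω| ≤ B / κ + (1 - κ) ^ n * |ε 0 ω| := by
  induction n with
  | zero =>
    have : 0 ≤ B / κ := by positivity
    simpa using this
  | succ n ih =>
    have h1 := ih (by omega) fun i hi hin => hB i hi (by omega)
    have h2 := hB (n + 1) (by omega) le_rfl
    have h3 := abs_le_of_mem_paramSpace (hθ₀mem _ (div_mem_Ioo (Nat.le_add_left 1 n) hn))
    have h4 : ε ((n + 1 : ℕ) : ℤ) ω =
        obs ε θ₀ T (n + 1) ω - θ₀ (((n + 1 : ℕ) : ℝ) / T) * ε n ω := by
      simp only [obs]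
      rw [show (((n + 1 : ℕ) : ℤ) - 1) = n by push_cast; ring]
      ring
    calc |ε ((n + 1 : ℕ) : ℤ) ω|
        ≤ |obs ε θ₀ T (n + 1) ω| + |θ₀ (((n + 1 : ℕ) : ℝ) / T) * ε n ω| := by
          rw [h4]; exact abs_sub _ _
      _ ≤ B + (1 - κ) * (B / κ + (1 - κ) ^ n * |ε 0 ω|) := by
          rw [abs_mul]
          exact add_le_add h2 (mul_le_mul h3 h1 (abs_nonneg _) (by linarith))
      _ = B / κ + (1 - κ) ^ (n + 1) * |ε 0 ω| := by
          field_simp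
          ring

variable {mΩ : MeasurableSpace Ω} {μ : Measure Ω}

theorem measurable_obs (hε : ∀ t, Measurable (ε t)) (T t : ℕ) : Measurable (obs ε θ₀ T t) :=
  (hε _).add ((hε _).const_mul _)

theorem measurable_obsPair (hε : ∀ t, Measurable (ε t)) (T t : ℕ) :
    Measurable (obsPair ε θ₀ T t) :=
  (measurable_obs hε T t).prodMk (measurable_obs hε T (t - 1))

/-- For large samples every single observation is bounded by a fixed constant, with high
probability. -/
theorem exists_obs_bound {ρ₀ : ℝ → ℝ} {δ : ℕ → ℝ} (hκ₁ : κ < 1)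
    (hδ : ∀ T, 0 < δ T ∧ δ T < 1 / 2) (hρ₀ : ρ₀ (1 / 2) ∈ paramSpace κ)
    (hscore : ScoreBounded μ (obs ε θ₀) (paramSpace κ) ρ₀ (fun T => timeSet (δ T))) :
    ∃ B : ℝ, 0 < B ∧ ∀ p : ℝ, 0 < p → ∃ N : ℕ, ∀ T i : ℕ, N ≤ T → i < T →
      μ {ω | B < |obs ε θ₀ T i ω|} ≤ ENNReal.ofReal p := by
  obtain ⟨r, hr, c, R, hR, hq⟩ := hscore
  set s := min r (1 - κ)
  have hs0 : 0 < s := lt_min hr (by linarith)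
  refine ⟨(|c| + 1) / s + 1, by positivity, fun p hp => ?_⟩
  obtain ⟨M, hM⟩ := hR p hp
  obtain ⟨N, hN⟩ := exists_nat_ge M
  -- The score at time i + 1 has Y_{i,T} as its regressor, hence the requirement i < T. Outside the
  -- exceptional event, T |R| ≤ M ≤ T gives |R| ≤ 1.
  refine ⟨N, fun T i hT hi => ?_⟩
  refine le_trans (measure_mono_ae ?_) (hM T (i + 1) (by omega) hi)
  filter_upwards [hq T (i + 1) (by omega) hi] with ω hω hB
  by_contra hcon
  have hcon' : (T : ℝ) * |R T (i + 1) ω| ≤ M := not_lt.1 hcon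
  have hT0 : (0 : ℝ) < T := by exact_mod_cast (by omega : 0 < T)
  have hNT : (N : ℝ) ≤ T := by exact_mod_cast hT
  have hR1 : |R T (i + 1) ω| ≤ 1 := by
    by_contra h
    nlinarith
  have h1 : obs ε θ₀ T i ω ^ 2 ≤ (c + R T (i + 1) ω) / s := by
    refine sq_le_of_auxScore (y := obs ε θ₀ T (i + 1) ω) hκ₁ hr hρ₀ fun ρ hρ hρr => ?_
    -- The rescaled time 1/2 belongs to every trimmed set because δ_T < 1/2.
    exact hω (1 / 2) ⟨(hδ T).2.le, by linarith [(hδ T).2]⟩ ρ hρ hρr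
  have h2 : (c + R T (i + 1) ω) / s ≤ (|c| + 1) / s := by
    gcongr
    · exact le_abs_self c
    · exact (le_abs_self _).trans hR1
  have h3 : 0 ≤ (|c| + 1) / s := by positivity
  have h4 : (|c| + 1) / s + 1 < |obs ε θ₀ T i ω| := hB
  rw [← sq_abs] at h1
  nlinarith

variable [IsProbabilityMeasure μ]

/-- Under the bounded score condition the errors are almost surely bounded. -/
theorem exists_noise_bound (hε : IsWhiteNoise μ ε) (hκ₀ : 0 < κ) (hκ₁ : κ < 1)
    (hθ₀mem : ∀ u ∈ Ioo (0 : ℝ) 1, θ₀ u ∈ paramSpace κ)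
    {ρ₀ : ℝ → ℝ} {δ : ℕ → ℝ} (hδ : ∀ T, 0 < δ T ∧ δ T < 1 / 2)
    (hρ₀ : ρ₀ (1 / 2) ∈ paramSpace κ)
    (hscore : ScoreBounded μ (obs ε θ₀) (paramSpace κ) ρ₀ (fun T => timeSet (δ T))) :
    ∃ B : ℝ, 1 ≤ B ∧ ∀ᵐ ω ∂μ, ∀ t : ℤ, |ε t ω| ≤ B := by
  obtain ⟨B, hB0, hB⟩ := exists_obs_bound hκ₁ hδ hρ₀ hscore
  refine ⟨B / κ + 1, by have : 0 < B / κ := by positivity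
                        linarith, ?_⟩
  rw [ae_all_iff]
  have hid : ∀ t, μ {ω | B / κ + 1 < |ε t ω|} = μ {ω | B / κ + 1 < |ε 0 ω|} := fun t =>
    (hε.identDistrib t).measure_mem_eq (s := {x | B / κ + 1 < |x|})
      (measurableSet_lt measurable_const measurable_norm)
  have hzero : μ {ω | B / κ + 1 < |ε 0 ω|} = 0 := by
    have htend : TendstoInMeasure μ (fun (n : ℕ) ω => (1 - κ) ^ n * ε 0 ω) atTop
        (fun _ => (0 : ℝ)) := by
      refine tendstoInMeasure_of_tendsto_ae
        (fun n => ((hε.measurable 0).const_mul _).aestronglyMeasurable) (ae_of_all _ fun ω => ?_)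
      simpa using (tendsto_pow_atTop_nhds_zero_of_lt_one (by linarith : 0 ≤ 1 - κ)
        (by linarith)).mul_const (ε 0 ω)
    rw [tendstoInMeasure_iff_norm] at htend
    have htend1 := htend 1 one_pos
    simp only [sub_zero, Real.norm_eq_abs] at htend1
    -- The tail probability of `ε 0` equals that of `ε n`. It is compared with P((1 - κ)^n |ε 0| ≥
    -- 1), which tends to 0; for fixed n the other contributions vanish as the row T grows.
    refine le_antisymm (ge_of_tendsto' htend1 fun n => ?_) zero_le
    refine ENNReal.le_of_forall_pos_le_add fun q hq _ => ?_
    -- The budget q is shared among the n observations used in the inversion.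
    obtain ⟨N, hN⟩ := hB (q / (n + 1)) (by positivity)
    set T := max N (n + 1)
    have hnT : n < T := lt_of_lt_of_le (Nat.lt_succ_self n) (le_max_right _ _)
    rw [← hid n]
    have hsub : {ω | B / κ + 1 < |ε n ω|} ⊆ {ω | 1 ≤ |(1 - κ) ^ n * ε 0 ω|} ∪
        ⋃ i ∈ Finset.Icc 1 n, {ω | B < |obs ε θ₀ T i ω|} := by
      intro ω hω
      by_contra hcon
      simp only [mem_union, mem_ofPred_eq, not_or, not_le, mem_iUnion, not_exists, not_lt,
        Finset.mem_Icc] at hcon hω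
      have h1 := abs_noise_le hκ₀ hκ₁ hθ₀mem n hnT (fun i hi hin => hcon.2 i ⟨hi, hin⟩) hB0.le
      have h2 := hcon.1
      rw [abs_mul, abs_of_nonneg (pow_nonneg (by linarith : 0 ≤ 1 - κ) n)] at h2
      linarith
    refine (measure_mono hsub).trans ((measure_union_le _ _).trans (add_le_add le_rfl ?_))
    refine (measure_biUnion_finset_le _ _).trans ?_
    calc ∑ i ∈ Finset.Icc 1 n, μ {ω | B < |obs ε θ₀ T i ω|}
        ≤ ∑ i ∈ Finset.Icc 1 n, ENNReal.ofReal (q / (n + 1)) := Finset.sum_le_sum fun i hi =>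
          hN T i (le_max_left _ _) (lt_of_le_of_lt (Finset.mem_Icc.1 hi).2 hnT)
      _ = ENNReal.ofReal (n * (q / (n + 1))) := by
          rw [Finset.sum_const, Nat.card_Icc, Nat.add_sub_cancel, nsmul_eq_mul,
            ENNReal.ofReal_mul (by positivity), ENNReal.ofReal_natCast]
      _ ≤ ENNReal.ofReal q := by
          refine ENNReal.ofReal_le_ofReal ?_
          rw [mul_div_assoc', div_le_iff₀ (by positivity)]
          nlinarith [q.coe_nonneg]
      _ = q := ENNReal.ofReal_coe_nnreal
  intro t
  rw [ae_iff]
  simp only [not_le]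
  rw [hid t, hzero]

end BoundedNoise

/-! ### A weak law for bounded, asymptotically uncorrelated variables -/

section WeakLaw

variable {Ω : Type*} {mΩ : MeasurableSpace Ω} {μ : Measure Ω} [IsProbabilityMeasure μ]

/-- The second moment of a sum of bounded variables whose products have small mean once they
are at least `k` apart. -/
theorem integral_sum_sq_le {ζ : ℕ → Ω → ℝ} (hζ : ∀ t, Measurable (ζ t)) {C η : ℝ}
    (hC : ∀ t, ∀ᵐ ω ∂μ, |ζ t ω| ≤ C) (hη : 0 ≤ η) {k : ℕ}
    (hk : ∀ t s : ℕ, k ≤ t → t + k ≤ s → ∫ ω, ζ t ω * ζ s ω ∂μ ≤ η) (T : ℕ) :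
    ∫ ω, (∑ t ∈ Finset.Icc 1 T, ζ t ω) ^ 2 ∂μ ≤ T ^ 2 * η + 4 * k * T * C ^ 2 := by
  have hint : ∀ t s, Integrable (fun ω => ζ t ω * ζ s ω) μ := fun t s => by
    refine Integrable.of_bound ((hζ t).mul (hζ s)).aestronglyMeasurable (C * C) ?_
    filter_upwards [hC t, hC s] with ω h1 h2
    rw [norm_mul]
    exact mul_le_mul h1 h2 (norm_nonneg _) ((abs_nonneg _).trans h1)
  have hCC : ∀ t s, ∫ ω, ζ t ω * ζ s ω ∂μ ≤ C ^ 2 := fun t s => by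
    calc ∫ ω, ζ t ω * ζ s ω ∂μ ≤ ∫ _ω, C ^ 2 ∂μ := by
          refine integral_mono_ae (hint t s) (integrable_const _) ?_
          filter_upwards [hC t, hC s] with ω h1 h2
          rw [sq]
          refine (le_abs_self _).trans ?_
          rw [abs_mul]
          exact mul_le_mul h1 h2 (abs_nonneg _) ((abs_nonneg _).trans h1)
      _ = C ^ 2 := by simp
  -- The exceptional pairs have an index below k or indices less than k apart: at most kT + kT + 2kT
  -- pairs.
  have hterm : ∀ t s, ∫ ω, ζ t ω * ζ s ω ∂μ ≤ η + ((if t < k then C ^ 2 else 0) +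
      (if s < k then C ^ 2 else 0) + (if t < s + k ∧ s < t + k then C ^ 2 else 0)) := by
    intro t s
    have hC2 := sq_nonneg C
    have h1 : 0 ≤ (if t < k then C ^ 2 else 0) := by split_ifs <;> simp [hC2]
    have h2 : 0 ≤ (if s < k then C ^ 2 else 0) := by split_ifs <;> simp [hC2]
    have h3 : 0 ≤ (if t < s + k ∧ s < t + k then C ^ 2 else 0) := by split_ifs <;> simp [hC2]
    by_cases ht : t < k
    · rw [if_pos ht] at h1 ⊢
      linarith [hCC t s]
    by_cases hs : s < k
    · rw [if_pos hs] at h2 ⊢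
      linarith [hCC t s]
    by_cases hts : t < s + k ∧ s < t + k
    · rw [if_pos hts] at h3 ⊢
      linarith [hCC t s]
    rcases not_and_or.1 hts with h | h
    · have := hk s t (by omega) (by omega)
      simp only [mul_comm (ζ s _)] at this
      linarith
    · linarith [hk t s (by omega) (by omega)]
  have hcount : ∀ (S : Finset ℕ) (n : ℕ), S.card ≤ n → (S.card : ℝ) * C ^ 2 ≤ n * C ^ 2 :=
    fun S n h => by gcongr
  have hlow : ∑ s ∈ Finset.Icc 1 T, (if s < k then C ^ 2 else 0) ≤ k * C ^ 2 := by
    rw [← Finset.sum_filter, Finset.sum_const, nsmul_eq_mul]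
    refine hcount _ _ ?_
    calc _ ≤ (Finset.range k).card := Finset.card_le_card fun s hs =>
          Finset.mem_range.2 (Finset.mem_filter.1 hs).2
      _ = k := Finset.card_range k
  have hdiag : ∀ t, ∑ s ∈ Finset.Icc 1 T, (if t < s + k ∧ s < t + k then C ^ 2 else 0) ≤
      2 * k * C ^ 2 := fun t => by
    rw [← Finset.sum_filter, Finset.sum_const, nsmul_eq_mul]
    have := hcount ((Finset.Icc 1 T).filter fun s => t < s + k ∧ s < t + k) (2 * k) (by
      calc _ ≤ (Finset.Ico (t + 1 - k) (t + k)).card := Finset.card_le_card fun s hs => by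
            have := (Finset.mem_filter.1 hs).2
            exact Finset.mem_Ico.2 ⟨by omega, by omega⟩
        _ ≤ 2 * k := by rw [Nat.card_Ico]; omega)
    push_cast at this
    exact this
  calc ∫ ω, (∑ t ∈ Finset.Icc 1 T, ζ t ω) ^ 2 ∂μ
      = ∑ t ∈ Finset.Icc 1 T, ∑ s ∈ Finset.Icc 1 T, ∫ ω, ζ t ω * ζ s ω ∂μ := by
        simp_rw [sq, Finset.sum_mul_sum]
        rw [integral_finsetSum _ fun t _ => integrable_finsetSum _ fun s _ => hint t s]
        refine Finset.sum_congr rfl fun t _ => ?_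
        rw [integral_finsetSum _ fun s _ => hint t s]
    _ ≤ ∑ t ∈ Finset.Icc 1 T, ∑ s ∈ Finset.Icc 1 T, (η + ((if t < k then C ^ 2 else 0) +
          (if s < k then C ^ 2 else 0) + (if t < s + k ∧ s < t + k then C ^ 2 else 0))) :=
        Finset.sum_le_sum fun t _ => Finset.sum_le_sum fun s _ => hterm t s
    _ ≤ ∑ t ∈ Finset.Icc 1 T, (T * η + (T * (if t < k then C ^ 2 else 0) +
          k * C ^ 2 + 2 * k * C ^ 2)) := by
        refine Finset.sum_le_sum fun t _ => ?_
        rw [Finset.sum_add_distrib, Finset.sum_add_distrib, Finset.sum_add_distrib,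
          Finset.sum_const, Finset.sum_const, Nat.card_Icc, Nat.add_sub_cancel, nsmul_eq_mul,
          nsmul_eq_mul]
        gcongr
        exact hdiag t
    _ ≤ T ^ 2 * η + 4 * k * T * C ^ 2 := by
        rw [Finset.sum_add_distrib, Finset.sum_add_distrib, Finset.sum_add_distrib,
          Finset.sum_const, Finset.sum_const, Finset.sum_const, Nat.card_Icc, Nat.add_sub_cancel,
          nsmul_eq_mul, nsmul_eq_mul, nsmul_eq_mul, ← Finset.mul_sum]
        have := mul_le_mul_of_nonneg_left hlow (Nat.cast_nonneg (α := ℝ) T)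
        nlinarith

/-- Weak law of large numbers for bounded, asymptotically uncorrelated variables. -/
theorem tendsto_measure_average_gt {ζ : ℕ → Ω → ℝ} (hζ : ∀ t, Measurable (ζ t)) {C : ℝ}
    (hC : ∀ t, ∀ᵐ ω ∂μ, |ζ t ω| ≤ C)
    (hk : ∀ η : ℝ, 0 < η → ∃ k : ℕ, ∀ t s : ℕ, k ≤ t → t + k ≤ s →
      ∫ ω, ζ t ω * ζ s ω ∂μ ≤ η) {a : ℝ} (ha : 0 < a) :
    Tendsto (fun T : ℕ => μ {ω | a < |1 / (T : ℝ) * ∑ t ∈ Finset.Icc 1 T, ζ t ω|})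
      atTop (𝓝 0) := by
  rw [ENNReal.tendsto_atTop_zero]
  intro q hq
  obtain ⟨q', hq'0, hq'⟩ : ∃ q' : ℝ, 0 < q' ∧ ENNReal.ofReal q' ≤ q := by
    rcases eq_or_ne q ⊤ with rfl | hqt
    · exact ⟨1, one_pos, le_top⟩
    · exact ⟨q.toReal, ENNReal.toReal_pos hq.ne' hqt, (ENNReal.ofReal_toReal hqt).le⟩
  -- With 4kC² ≤ Tη the second moment is at most 2T²η = a² T² q', as Chebyshev's inequality
  -- requires.
  set η := q' * a ^ 2 / 2
  have hη : 0 < η := by positivity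
  obtain ⟨k, hk⟩ := hk η hη
  obtain ⟨N, hN⟩ := exists_nat_ge (4 * k * C ^ 2 / η)
  refine ⟨max N 1, fun T hT => le_trans ?_ hq'⟩
  have hT0 : (0 : ℝ) < T := by exact_mod_cast (le_max_right N 1).trans hT
  have hNT : 4 * k * C ^ 2 ≤ T * η := by
    rw [div_le_iff₀ hη] at hN
    refine hN.trans ?_
    gcongr
    exact_mod_cast (le_max_left N 1).trans hT
  set S : Ω → ℝ := fun ω => ∑ t ∈ Finset.Icc 1 T, ζ t ω
  have hSm : Measurable S := Finset.measurable_sum _ fun t _ => hζ t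
  have hSi : Integrable (fun ω => S ω ^ 2) μ := by
    refine Integrable.of_bound (hSm.pow_const 2).aestronglyMeasurable
      ((∑ _t ∈ Finset.Icc 1 T, C) ^ 2) ?_
    filter_upwards [ae_all_iff.2 hC] with ω h
    rw [norm_pow]
    exact pow_le_pow_left₀ (norm_nonneg _)
      ((Finset.abs_sum_le_sum_abs _ _).trans (Finset.sum_le_sum fun t _ => h t)) 2
  have hmarkov := mul_meas_ge_le_integral_of_nonneg (μ := μ) (f := fun ω => S ω ^ 2)
    (ae_of_all _ fun ω => sq_nonneg (S ω)) hSi (a ^ 2 * T ^ 2)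
  have hsq := integral_sum_sq_le hζ hC hη.le hk T
  have hle : μ.real {ω | a ^ 2 * T ^ 2 ≤ S ω ^ 2} ≤ q' := by
    have h1 : a ^ 2 * T ^ 2 * μ.real {ω | a ^ 2 * T ^ 2 ≤ S ω ^ 2} ≤ a ^ 2 * T ^ 2 * q' := by
      refine hmarkov.trans (hsq.trans ?_)
      have : 4 * k * T * C ^ 2 ≤ T * (T * η) := by nlinarith
      calc T ^ 2 * η + 4 * k * T * C ^ 2 ≤ T ^ 2 * η + T * (T * η) := by linarith
        _ = a ^ 2 * T ^ 2 * q' := by simp only [η]; ring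
    exact le_of_mul_le_mul_left h1 (by positivity)
  calc μ {ω | a < |1 / (T : ℝ) * S ω|} ≤ μ {ω | a ^ 2 * T ^ 2 ≤ S ω ^ 2} := by
        refine measure_mono fun ω hω => ?_
        have h1 : a < |1 / (T : ℝ) * S ω| := hω
        rw [abs_mul, abs_of_pos (by positivity : 0 < 1 / (T : ℝ)), one_div,
          lt_inv_mul_iff₀ hT0] at h1
        change a ^ 2 * T ^ 2 ≤ S ω ^ 2
        rw [← mul_pow, ← sq_abs (S ω), mul_comm]
        exact pow_le_pow_left₀ (by positivity) h1.le 2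
    _ = ENNReal.ofReal (μ.real {ω | a ^ 2 * T ^ 2 ≤ S ω ^ 2}) :=
        (ENNReal.ofReal_toReal (measure_ne_top _ _)).symm
    _ ≤ ENNReal.ofReal q' := ENNReal.ofReal_le_ofReal hle

end WeakLaw

/-! ### Recovering errors from observations, and a law of large numbers for lagged products -/

section Inversion

variable {Ω : Type*} {ε : ℤ → Ω → ℝ} {κ : ℝ} {θ₀ : ℝ → ℝ}

/-- The error at time `s + n` reconstructed from the observations at times `s + 1, …, s + n`,
starting from the value `0` at time `s`. -/
noncomputable def noiseApprox (ε : ℤ → Ω → ℝ) (θ₀ : ℝ → ℝ) (T s : ℕ) : ℕ → Ω → ℝ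
  | 0 => fun _ => 0
  | n + 1 => fun ω => obs ε θ₀ T (s + n + 1) ω -
      θ₀ (((s + n + 1 : ℕ) : ℝ) / T) * noiseApprox ε θ₀ T s n ω

/-- The true error satisfies the same recursion as its approximation, so the discrepancy is
multiplied by a value of -θ₀ at each step, of modulus at most 1 - κ. -/
theorem abs_noise_sub_noiseApprox_le (hκ₁ : κ < 1)
    (hθ₀mem : ∀ u ∈ Ioo (0 : ℝ) 1, θ₀ u ∈ paramSpace κ) {T s : ℕ} {ω : Ω} (n : ℕ)
    (hn : s + n < T) :
    |ε ((s + n : ℕ) : ℤ) ω - noiseApprox ε θ₀ T s n ω| ≤ (1 - κ) ^ n * |ε s ω| := by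
  induction n with
  | zero => simp [noiseApprox]
  | succ n ih =>
    have h1 := ih (by omega)
    have h3 := abs_le_of_mem_paramSpace
      (hθ₀mem _ (div_mem_Ioo (Nat.le_add_left 1 (s + n)) hn))
    have h4 : ε ((s + (n + 1) : ℕ) : ℤ) ω - noiseApprox ε θ₀ T s (n + 1) ω =
        -(θ₀ (((s + n + 1 : ℕ) : ℝ) / T) *
          (ε ((s + n : ℕ) : ℤ) ω - noiseApprox ε θ₀ T s n ω)) := by
      simp only [noiseApprox, obs]
      rw [show (((s + n + 1 : ℕ) : ℤ) - 1) = (s + n : ℕ) by push_cast; ring,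
        show s + (n + 1) = s + n + 1 by ring]
      ring
    rw [h4, abs_neg, abs_mul, pow_succ, mul_comm ((1 - κ) ^ n), mul_assoc]
    exact mul_le_mul h3 h1 (abs_nonneg _) (by linarith)

theorem measurable_noiseApprox_past {T s t : ℕ} (n : ℕ) (hn : s + n ≤ t) :
    Measurable[pastField (obsPair ε θ₀) T t] (noiseApprox ε θ₀ T s n) := by
  induction n with
  | zero => exact measurable_const
  | succ n ih =>
    exact (measurable_fst.comp (measurable_pastField (obsPair ε θ₀) (i := s + n + 1)
      (by omega) (by omega))).sub ((ih (by omega)).const_mul _)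

theorem measurable_noiseApprox_future {T s t : ℕ} (n : ℕ) (hn : s + n ≤ T) (hs : t ≤ s + 1) :
    Measurable[futureField (obsPair ε θ₀) T t] (noiseApprox ε θ₀ T s n) := by
  induction n with
  | zero => exact measurable_const
  | succ n ih =>
    exact (measurable_fst.comp (measurable_futureField (obsPair ε θ₀) (i := s + n + 1)
      (by omega) (by omega))).sub ((ih (by omega)).const_mul _)

theorem abs_mul_sub_mul_le {x y x' y' B d : ℝ} (hd1 : d ≤ 1)
    (hx : |x| ≤ B) (hy : |y| ≤ B) (hxx : |x - x'| ≤ B * d) (hyy : |y - y'| ≤ B * d) :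
    |x * y - x' * y'| ≤ 3 * B ^ 2 * d := by
  have hB : 0 ≤ B := (abs_nonneg _).trans hx
  have hBd : 0 ≤ B * d := (abs_nonneg _).trans hxx
  have hy' : |y'| ≤ 2 * B := by
    have h1 : |y'| ≤ |y| + |y - y'| := by
      have := abs_sub y (y - y')
      rwa [sub_sub_cancel] at this
    nlinarith
  calc |x * y - x' * y'| = |x * (y - y') + (x - x') * y'| := by ring_nf
    _ ≤ |x| * |y - y'| + |x - x'| * |y'| := by
        refine (abs_add_le _ _).trans ?_
        rw [abs_mul, abs_mul]
    _ ≤ B * (B * d) + B * d * (2 * B) := by gcongr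
    _ = 3 * B ^ 2 * d := by ring

variable {mΩ : MeasurableSpace Ω} {μ : Measure Ω}

/-- The centred product of two errors at lags `a` and `b`. -/
noncomputable def lagProd (x : ℤ → ℝ) (a b t : ℕ) : ℝ :=
  x ((t : ℤ) - a) * x ((t : ℤ) - b) - if a = b then 1 else 0

/-- Lagged error products are approximated by functions of finitely many observations. -/
theorem exists_lagProd_approx (hκ₀ : 0 < κ) (hκ₁ : κ < 1)
    (hθ₀mem : ∀ u ∈ Ioo (0 : ℝ) 1, θ₀ u ∈ paramSpace κ) {B : ℝ}
    (hB : ∀ᵐ ω ∂μ, ∀ t : ℤ, |ε t ω| ≤ B) {a b D L t T : ℕ} (ha : a ≤ D) (hb : b ≤ D)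
    (ht : D + L ≤ t) (hT : t < T) :
    ∃ X : Ω → ℝ, Measurable[pastField (obsPair ε θ₀) T t] X ∧
      Measurable[futureField (obsPair ε θ₀) T (t - (D + L))] X ∧
      ∀ᵐ ω ∂μ, |lagProd (fun i => ε i ω) a b t - X ω| ≤ 3 * B ^ 2 * (1 - κ) ^ L := by
  refine ⟨fun ω => noiseApprox ε θ₀ T (t - a - L) L ω * noiseApprox ε θ₀ T (t - b - L) L ω -
    (if a = b then 1 else 0), ?_, ?_, ?_⟩
  · exact ((measurable_noiseApprox_past L (by omega)).mul
      (measurable_noiseApprox_past L (by omega))).sub_const _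
  · exact ((measurable_noiseApprox_future L (by omega) (by omega)).mul
      (measurable_noiseApprox_future L (by omega) (by omega))).sub_const _
  · filter_upwards [hB] with ω h
    rw [lagProd, sub_sub_sub_cancel_right]
    have key : ∀ c ≤ D, |ε ((t : ℤ) - c) ω - noiseApprox ε θ₀ T (t - c - L) L ω| ≤
        B * (1 - κ) ^ L := fun c hc => by
      have h1 := abs_noise_sub_noiseApprox_le (ε := ε) (ω := ω) hκ₁ hθ₀mem (s := t - c - L) L
        (show t - c - L + L < T by omega)
      rw [show ((t - c - L + L : ℕ) : ℤ) = (t : ℤ) - c by omega] at h1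
      rw [mul_comm]
      refine h1.trans ?_
      gcongr
      exact h _
    exact abs_mul_sub_mul_le (pow_le_one₀ (by linarith) (by linarith)) (h _) (h _)
      (key a ha) (key b hb)

variable [IsProbabilityMeasure μ]

theorem integral_lagProd (hε : IsWhiteNoise μ ε) {B : ℝ}
    (hB : ∀ᵐ ω ∂μ, ∀ t : ℤ, |ε t ω| ≤ B) (a b t : ℕ) :
    ∫ ω, lagProd (fun i => ε i ω) a b t ∂μ = 0 := by
  have hint : Integrable (fun ω => ε ((t : ℤ) - a) ω * ε ((t : ℤ) - b) ω) μ := by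
    refine Integrable.of_bound ((hε.measurable _).mul (hε.measurable _)).aestronglyMeasurable
      (B * B) ?_
    filter_upwards [hB] with ω h
    rw [norm_mul]
    exact mul_le_mul (h _) (h _) (norm_nonneg _) ((abs_nonneg _).trans (h 0))
  simp only [lagProd]
  rw [integral_sub hint (integrable_const _)]
  by_cases hab : a = b
  · subst hab
    have := hε.unit_variance ((t : ℤ) - a)
    simp only [sq] at this
    simp [this]
  · rw [hε.uncorrelated _ _ (by omega)]
    simp [hab]

theorem measurable_lagProd (hε : ∀ t, Measurable (ε t)) (a b t : ℕ) :
    Measurable fun ω => lagProd (fun i => ε i ω) a b t :=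
  ((hε _).mul (hε _)).sub_const _

theorem abs_lagProd_le {x : ℤ → ℝ} {B : ℝ} (hB1 : 1 ≤ B) (hB : ∀ t, |x t| ≤ B) (a b t : ℕ) :
    |lagProd x a b t| ≤ 2 * B ^ 2 := by
  have h1 : |x ((t : ℤ) - a) * x ((t : ℤ) - b)| ≤ B * B := by
    rw [abs_mul]
    exact mul_le_mul (hB _) (hB _) (abs_nonneg _) (by linarith)
  have h2 : |(if a = b then 1 else 0 : ℝ)| ≤ 1 := by split_ifs <;> simp
  calc |lagProd x a b t| ≤ _ := abs_sub _ _
    _ ≤ 2 * B ^ 2 := by nlinarith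

/-- Each lagged product is replaced by its approximation from a window of D + L past observations;
the windows are at least k apart, so the mixing covariance inequality applies. With d = (1 - κ)^L,
replacement costs 21 B⁴ d, the product of the approximate means at most 9 B⁴ d, and mixing 4φ(5B²)².
-/
theorem integral_lagProd_mul_le (hε : IsWhiteNoise μ ε) (hκ₀ : 0 < κ) (hκ₁ : κ < 1)
    (hθ₀mem : ∀ u ∈ Ioo (0 : ℝ) 1, θ₀ u ∈ paramSpace κ) {B : ℝ} (hB1 : 1 ≤ B)
    (hB : ∀ᵐ ω ∂μ, ∀ t : ℤ, |ε t ω| ≤ B) {a b D L k t s : ℕ} (ha : a ≤ D) (hb : b ≤ D)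
    (ht : D + L ≤ t) (hs : t + k + (D + L) ≤ s) :
    ∫ ω, lagProd (fun i => ε i ω) a b t * lagProd (fun i => ε i ω) a b s ∂μ ≤
      B ^ 4 * (30 * (1 - κ) ^ L + 100 * phiMix μ (obsPair ε θ₀) k) := by
  set d := (1 - κ) ^ L
  have hd0 : 0 ≤ d := pow_nonneg (by linarith) L
  have hd1 : d ≤ 1 := pow_le_one₀ (by linarith) (by linarith)
  set φ := phiMix μ (obsPair ε θ₀) k
  have hφ : 0 ≤ φ := phiMix_nonneg _ k
  have hm := measurable_obsPair (θ₀ := θ₀) hε.measurable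
  obtain ⟨X, hXp, -, hX⟩ := exists_lagProd_approx hκ₀ hκ₁ hθ₀mem hB ha hb ht
    (show t < s + 1 by omega)
  obtain ⟨Y, -, hYf, hY⟩ := exists_lagProd_approx hκ₀ hκ₁ hθ₀mem hB ha hb
    (show D + L ≤ s by omega) (Nat.lt_succ_self s)
  set P : Ω → ℝ := fun ω => lagProd (fun i => ε i ω) a b t with hP
  set Q : Ω → ℝ := fun ω => lagProd (fun i => ε i ω) a b s with hQ
  have hPb : ∀ᵐ ω ∂μ, |P ω| ≤ 2 * B ^ 2 := by
    filter_upwards [hB] with ω h using abs_lagProd_le hB1 h a b t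
  have hQb : ∀ᵐ ω ∂μ, |Q ω| ≤ 2 * B ^ 2 := by
    filter_upwards [hB] with ω h using abs_lagProd_le hB1 h a b s
  have hB2 : 0 ≤ B ^ 2 := sq_nonneg B
  have hbd : ∀ p x : ℝ, |p| ≤ 2 * B ^ 2 → |p - x| ≤ 3 * B ^ 2 * d → |x| ≤ 5 * B ^ 2 := by
    intro p x h1 h2
    have h3 : |x| ≤ |p| + |p - x| := by
      have := abs_sub p (p - x)
      rwa [sub_sub_cancel] at this
    nlinarith
  have hXb : ∀ᵐ ω ∂μ, |X ω| ≤ 5 * B ^ 2 := by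
    filter_upwards [hPb, hX] with ω h1 h2 using hbd _ _ h1 h2
  have hYb : ∀ᵐ ω ∂μ, |Y ω| ≤ 5 * B ^ 2 := by
    filter_upwards [hQb, hY] with ω h1 h2 using hbd _ _ h1 h2
  have hPm : Measurable P := measurable_lagProd hε.measurable a b t
  have hQm : Measurable Q := measurable_lagProd hε.measurable a b s
  have hXm : Measurable X := hXp.mono (pastField_le hm _ _) le_rfl
  have hYm : Measurable Y := hYf.mono (futureField_le hm _ _) le_rfl
  have hPi : Integrable P μ := Integrable.of_bound hPm.aestronglyMeasurable _ hPb
  have hQi : Integrable Q μ := Integrable.of_bound hQm.aestronglyMeasurable _ hQb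
  have hXi : Integrable X μ := Integrable.of_bound hXm.aestronglyMeasurable _ hXb
  have hYi : Integrable Y μ := Integrable.of_bound hYm.aestronglyMeasurable _ hYb
  have hPQ : Integrable (fun ω => P ω * Q ω) μ := hPi.mul_bdd hQm.aestronglyMeasurable hQb
  have hXY : Integrable (fun ω => X ω * Y ω) μ := hXi.mul_bdd hYm.aestronglyMeasurable hYb
  have hsmall : ∀ {p x : Ω → ℝ}, Integrable p μ → Integrable x μ → ∫ ω, p ω ∂μ = 0 →
      (∀ᵐ ω ∂μ, |p ω - x ω| ≤ 3 * B ^ 2 * d) → |∫ ω, x ω ∂μ| ≤ 3 * B ^ 2 * d := by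
    intro p x hp hx h0 hpx
    have : ∫ ω, x ω ∂μ = -∫ ω, (p ω - x ω) ∂μ := by
      rw [integral_sub hp hx, h0, zero_sub, neg_neg]
    rw [this, abs_neg]
    simpa using norm_integral_le_of_norm_le_const (μ := μ) (f := fun ω => p ω - x ω) hpx
  have hEX := hsmall hPi hXi (integral_lagProd hε hB a b t) hX
  have hEY := hsmall hQi hYi (integral_lagProd hε hB a b s) hY
  -- The errors do not depend on the row, so any row may be used. Row s + 1 keeps all rescaled times
  -- up to s strictly inside (0, 1), where |θ₀| ≤ 1 - κ.
  have hcov := (mixBound_pastField_futureField (μ := μ) (obsPair ε θ₀) (s + 1) t k).integral_mul_le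
    hφ (pastField_le hm _ _) (futureField_le hm _ _) hXp
    (hYf.mono (futureField_anti _ (by omega)) le_rfl) hXb hYb
  have hdiff : ∫ ω, P ω * Q ω ∂μ ≤ ∫ ω, X ω * Y ω ∂μ + 21 * B ^ 4 * d := by
    calc ∫ ω, P ω * Q ω ∂μ ≤ ∫ ω, (X ω * Y ω + 21 * B ^ 4 * d) ∂μ := by
          refine integral_mono_ae hPQ (hXY.add (integrable_const _)) ?_
          filter_upwards [hPb, hYb, hX, hY] with ω h1 h2 h3 h4
          have h5 : |P ω * (Q ω - Y ω)| ≤ 2 * B ^ 2 * (3 * B ^ 2 * d) := by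
            rw [abs_mul]; gcongr
          have h6 : |(P ω - X ω) * Y ω| ≤ 3 * B ^ 2 * d * (5 * B ^ 2) := by
            rw [abs_mul]; gcongr
          have h7 := (abs_le.1 h5).2
          have h8 := (abs_le.1 h6).2
          change P ω * Q ω ≤ X ω * Y ω + 21 * B ^ 4 * d
          nlinarith
      _ = ∫ ω, X ω * Y ω ∂μ + 21 * B ^ 4 * d := by
          rw [integral_add hXY (integrable_const _)]; simp
  have hprod : (∫ ω, X ω ∂μ) * (∫ ω, Y ω ∂μ) ≤ 9 * B ^ 4 * d := by
    refine (le_abs_self _).trans ?_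
    rw [abs_mul]
    calc |∫ ω, X ω ∂μ| * |∫ ω, Y ω ∂μ| ≤ (3 * B ^ 2 * d) * (3 * B ^ 2 * d) := by gcongr
      _ = 9 * B ^ 4 * d * d := by ring
      _ ≤ 9 * B ^ 4 * d := mul_le_of_le_one_right (by positivity) hd1
  calc ∫ ω, P ω * Q ω ∂μ ≤ 9 * B ^ 4 * d + 4 * φ * (5 * B ^ 2) * (5 * B ^ 2) + 21 * B ^ 4 * d := by
        linarith
    _ = B ^ 4 * (30 * d + 100 * φ) := by ring

/-- Law of large numbers for the lagged products of the errors. -/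
theorem tendsto_measure_lagProd_average (hε : IsWhiteNoise μ ε) (hκ₀ : 0 < κ) (hκ₁ : κ < 1)
    (hθ₀mem : ∀ u ∈ Ioo (0 : ℝ) 1, θ₀ u ∈ paramSpace κ) {B : ℝ} (hB1 : 1 ≤ B)
    (hB : ∀ᵐ ω ∂μ, ∀ t : ℤ, |ε t ω| ≤ B)
    (hφ : Tendsto (phiMix μ (obsPair ε θ₀)) atTop (𝓝 0)) (a b : ℕ) {c : ℝ} (hc : 0 < c) :
    Tendsto (fun T : ℕ =>
      μ {ω | c < |1 / (T : ℝ) * ∑ t ∈ Finset.Icc 1 T, lagProd (fun i => ε i ω) a b t|})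
      atTop (𝓝 0) := by
  refine tendsto_measure_average_gt (C := 2 * B ^ 2)
    (ζ := fun t ω => lagProd (fun i => ε i ω) a b t)
    (fun t => measurable_lagProd hε.measurable a b t)
    (fun t => by filter_upwards [hB] with ω h using abs_lagProd_le hB1 h a b t)
    (fun η hη => ?_) hc
  have hlim : Tendsto (fun n : ℕ => B ^ 4 * (30 * (1 - κ) ^ n +
      100 * phiMix μ (obsPair ε θ₀) n)) atTop (𝓝 (B ^ 4 * (30 * 0 + 100 * 0))) :=
    (((tendsto_pow_atTop_nhds_zero_of_lt_one (by linarith) (by linarith)).const_mul 30).add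
      (hφ.const_mul 100)).const_mul _
  simp only [mul_zero, add_zero] at hlim
  obtain ⟨n, hn⟩ := (hlim.eventually (gt_mem_nhds hη)).exists
  refine ⟨n + (a + b + n), fun t s ht hs => (integral_lagProd_mul_le (D := a + b) (L := n) (k := n)
    hε hκ₀ hκ₁ hθ₀mem hB1 hB (by omega) (by omega) (by omega) (by omega)).trans hn.le⟩

end Inversion

/-! ### The binding function and the simulated estimator -/

section Simulated

/-- The binding function from the moving average to the autoregressive parameter. -/
noncomputable def binding (θ : ℝ) : ℝ := θ / (1 + θ ^ 2)

theorem abs_binding_le (θ : ℝ) : |binding θ| ≤ 1 / 2 := by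
  have h : 0 < 1 + θ ^ 2 := by positivity
  rw [binding, abs_div, abs_of_pos h, div_le_iff₀ h]
  nlinarith [sq_nonneg (|θ| - 1), sq_abs θ]

variable {Ω : Type*}

/-- The parameter is separated from the randomness: θ enters polynomially, and the averages `A a b`
do not involve it. Controlling those with lags at most 2 controls all θ at once. -/
theorem sum_mul_simObs_eq (ε : ℤ → Ω → ℝ) {T : ℕ} (hT : 1 ≤ T) (θ : ℝ) (ω : Ω)
    {A : ℕ → ℕ → ℝ}
    (hA : ∀ a b, A a b = 1 / (T : ℝ) * ∑ t ∈ Finset.Icc 1 T, lagProd (fun i => ε i ω) a b t) :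
    (∑ t ∈ Finset.Icc 1 T, simObs ε θ (t - 1) ω * simObs ε θ t ω =
      T * (θ + (A 1 0 + θ * A 1 1 + θ * A 2 0 + θ ^ 2 * A 2 1))) ∧
    (∑ t ∈ Finset.Icc 1 T, simObs ε θ (t - 1) ω ^ 2 =
      T * (1 + θ ^ 2 + (A 1 1 + 2 * θ * A 2 1 + θ ^ 2 * A 2 2))) := by
  have hT0 : (T : ℝ) ≠ 0 := by positivity
  have hA' : ∀ a b, T * A a b = ∑ t ∈ Finset.Icc 1 T, lagProd (fun i => ε i ω) a b t := by
    intro a b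
    rw [hA]
    field_simp
  have hconst : ∀ x : ℝ, T * x = ∑ _t ∈ Finset.Icc 1 T, x := fun x => by simp
  have hlag : ∀ t ∈ Finset.Icc 1 T, simObs ε θ (t - 1) ω =
      ε ((t : ℤ) - (1 : ℕ)) ω + θ * ε ((t : ℤ) - (2 : ℕ)) ω := fun t ht => by
    have h1 := (Finset.mem_Icc.1 ht).1
    rw [simObs, show ((t - 1 : ℕ) : ℤ) = (t : ℤ) - (1 : ℕ) by omega,
      show (t : ℤ) - (1 : ℕ) - 1 = (t : ℤ) - (2 : ℕ) by omega]
  constructor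
  · rw [show T * (θ + (A 1 0 + θ * A 1 1 + θ * A 2 0 + θ ^ 2 * A 2 1)) =
        T * θ + T * A 1 0 + θ * (T * A 1 1) + θ * (T * A 2 0) + θ ^ 2 * (T * A 2 1) by ring,
      hA', hA', hA', hA', hconst, Finset.mul_sum, Finset.mul_sum, Finset.mul_sum,
      ← Finset.sum_add_distrib, ← Finset.sum_add_distrib, ← Finset.sum_add_distrib,
      ← Finset.sum_add_distrib]
    refine Finset.sum_congr rfl fun t ht => ?_
    rw [hlag t ht]
    simp only [simObs, lagProd]
    norm_num
    ring
  · rw [show T * (1 + θ ^ 2 + (A 1 1 + 2 * θ * A 2 1 + θ ^ 2 * A 2 2)) =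
        T * (1 + θ ^ 2) + T * A 1 1 + 2 * θ * (T * A 2 1) + θ ^ 2 * (T * A 2 2) by ring,
      hA', hA', hA', hconst, Finset.mul_sum, Finset.mul_sum,
      ← Finset.sum_add_distrib, ← Finset.sum_add_distrib, ← Finset.sum_add_distrib]
    refine Finset.sum_congr rfl fun t ht => ?_
    rw [hlag t ht]
    simp only [lagProd]
    norm_num
    ring

/-- The ratio of perturbed moments is close to the binding function. -/
theorem abs_div_sub_binding_le {θ p q η : ℝ} (hη : η ≤ 1 / 2) (hp : |p| ≤ η) (hq : |q| ≤ η) :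
    |(θ + p) / (1 + θ ^ 2 + q) - binding θ| ≤ 4 * η := by
  have hη0 : 0 ≤ η := (abs_nonneg _).trans hp
  have hD : 1 / 2 ≤ 1 + θ ^ 2 + q := by nlinarith [(abs_le.1 hq).1, sq_nonneg θ]
  have hD0 : 0 < 1 + θ ^ 2 + q := by linarith
  have h1 : 1 + θ ^ 2 ≠ 0 := by positivity
  have e : (θ + p) / (1 + θ ^ 2 + q) - binding θ =
      (p - binding θ * q) / (1 + θ ^ 2 + q) := by
    rw [eq_div_iff hD0.ne', sub_mul, div_mul_cancel₀ _ hD0.ne']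
    have : binding θ * (1 + θ ^ 2) = θ := div_mul_cancel₀ _ h1
    linear_combination -this
  rw [e, abs_div, abs_of_pos hD0, div_le_iff₀ hD0]
  have h2 : |p - binding θ * q| ≤ η + 1 / 2 * η := by
    refine (abs_sub _ _).trans ?_
    rw [abs_mul]
    gcongr
    exact abs_binding_le θ
  nlinarith

/-- Since |θ| ≤ 1, numerator and denominator are perturbed by at most 4η ≤ 1/2. The denominator thus
stays positive, which also gives the continuity needed for a maximizer to exist. -/
theorem rhoSimPath_close {ε : ℤ → Ω → ℝ} {κ : ℝ} (hκ₀ : 0 < κ) (hκ₁ : κ < 1) {T : ℕ}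
    (hT : 1 ≤ T) {ω : Ω} {η : ℝ} (hη : η ≤ 1 / 8)
    (hA : ∀ a ∈ Finset.range 3, ∀ b ∈ Finset.range 3,
      |1 / (T : ℝ) * ∑ t ∈ Finset.Icc 1 T, lagProd (fun i => ε i ω) a b t| ≤ η) :
    ContinuousOn (fun θ => rhoSimPath ε T θ ω) (paramSpace κ) ∧
      ∀ θ ∈ paramSpace κ, |rhoSimPath ε T θ ω - binding θ| ≤ 16 * η := by
  set A : ℕ → ℕ → ℝ := fun a b =>
    1 / (T : ℝ) * ∑ t ∈ Finset.Icc 1 T, lagProd (fun i => ε i ω) a b t with hAdef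
  have hT0 : (T : ℝ) ≠ 0 := by positivity
  have heq : ∀ θ, rhoSimPath ε T θ ω =
      (θ + (A 1 0 + θ * A 1 1 + θ * A 2 0 + θ ^ 2 * A 2 1)) /
        (1 + θ ^ 2 + (A 1 1 + 2 * θ * A 2 1 + θ ^ 2 * A 2 2)) := fun θ => by
    obtain ⟨h1, h2⟩ := sum_mul_simObs_eq ε hT θ ω (A := A) fun a b => rfl
    rw [rhoSimPath, h1, h2, mul_div_mul_left _ _ hT0]
  have b10 : |A 1 0| ≤ η := hA 1 (by simp) 0 (by simp)
  have b11 : |A 1 1| ≤ η := hA 1 (by simp) 1 (by simp)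
  have b20 : |A 2 0| ≤ η := hA 2 (by simp) 0 (by simp)
  have b21 : |A 2 1| ≤ η := hA 2 (by simp) 1 (by simp)
  have b22 : |A 2 2| ≤ η := hA 2 (by simp) 2 (by simp)
  have hη0 : 0 ≤ η := (abs_nonneg _).trans b10
  have hbd : ∀ θ ∈ paramSpace κ, |A 1 0 + θ * A 1 1 + θ * A 2 0 + θ ^ 2 * A 2 1| ≤ 4 * η ∧
      |A 1 1 + 2 * θ * A 2 1 + θ ^ 2 * A 2 2| ≤ 4 * η := fun θ hθ => by
    have hθ1 : |θ| ≤ 1 := (abs_le_of_mem_paramSpace hθ).trans (by linarith)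
    have hθ2 : |θ ^ 2| ≤ 1 := by rw [abs_pow]; exact pow_le_one₀ (abs_nonneg _) hθ1
    have hm : ∀ x y : ℝ, |x| ≤ 1 → |y| ≤ η → |x * y| ≤ η := fun x y hx hy => by
      rw [abs_mul]
      calc |x| * |y| ≤ 1 * η := by gcongr
        _ = η := one_mul η
    have m1 := abs_le.1 (hm _ _ hθ1 b11)
    have m2 := abs_le.1 (hm _ _ hθ1 b20)
    have m3 := abs_le.1 (hm _ _ hθ2 b21)
    have m4 := abs_le.1 (hm _ _ hθ1 b21)
    have m5 := abs_le.1 (hm _ _ hθ2 b22)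
    have m6 := abs_le.1 b10
    have m7 := abs_le.1 b11
    constructor <;> rw [abs_le] <;> constructor <;> linarith
  constructor
  · simp only [heq]
    refine ContinuousOn.div (by fun_prop) (by fun_prop) fun θ hθ => ?_
    have := (abs_le.1 (hbd θ hθ).2).1
    nlinarith [sq_nonneg θ]
  · intro θ hθ
    rw [heq]
    have := abs_div_sub_binding_le (θ := θ) (η := 4 * η) (by linarith) (hbd θ hθ).1 (hbd θ hθ).2
    linarith

variable {mΩ : MeasurableSpace Ω} {μ : Measure Ω} [IsProbabilityMeasure μ]

/-- Uniform consistency of the simulated auxiliary estimator. -/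
theorem exists_rhoSim_close {ε : ℤ → Ω → ℝ} {κ : ℝ} {θ₀ : ℝ → ℝ} (hε : IsWhiteNoise μ ε)
    (hκ₀ : 0 < κ) (hκ₁ : κ < 1) (hθ₀mem : ∀ u ∈ Ioo (0 : ℝ) 1, θ₀ u ∈ paramSpace κ) {B : ℝ}
    (hB1 : 1 ≤ B) (hB : ∀ᵐ ω ∂μ, ∀ t : ℤ, |ε t ω| ≤ B)
    (hφ : Tendsto (phiMix μ (obsPair ε θ₀)) atTop (𝓝 0)) {H : ℕ} (hH : 0 < H)
    {εs : Fin H → ℤ → Ω → ℝ}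
    (hεs : ∀ j, IdentDistrib (fun ω t => εs j t ω) (fun ω t => ε t ω) μ μ)
    {η : ℝ} (hη : 0 < η) :
    ∃ S : ℕ → Set Ω, Tendsto (fun T => μ (S T)) atTop (𝓝 0) ∧ ∀ T, 1 ≤ T → ∀ ω ∉ S T,
      ContinuousOn (fun θ => rhoSim εs T θ ω) (paramSpace κ) ∧
        ∀ θ ∈ paramSpace κ, |rhoSim εs T θ ω - binding θ| ≤ η := by
  set c := min (η / 16) (1 / 8)
  have hc : 0 < c := lt_min (by positivity) (by norm_num)
  set V : Fin H → ℕ → ℕ → ℕ → Set Ω := fun j a b T =>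
    {ω | c < |1 / (T : ℝ) * ∑ t ∈ Finset.Icc 1 T, lagProd (fun i => εs j i ω) a b t|}
  have hV : ∀ j a b, Tendsto (fun T => μ (V j a b T)) atTop (𝓝 0) := fun j a b => by
    refine (tendsto_measure_lagProd_average hε hκ₀ hκ₁ hθ₀mem hB1 hB hφ a b hc).congr fun T => ?_
    have hm : Measurable fun x : ℤ → ℝ =>
        |1 / (T : ℝ) * ∑ t ∈ Finset.Icc 1 T, lagProd x a b t| := by
      refine Measurable.norm (f := fun x : ℤ → ℝ => 1 / (T : ℝ) * ∑ t ∈ Finset.Icc 1 T,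
        lagProd x a b t) (Measurable.const_mul (Finset.measurable_sum _ fun t _ => ?_) _)
      have hp : ∀ i : ℤ, Measurable fun x : ℤ → ℝ => x i := fun i => measurable_pi_apply i
      exact ((hp _).mul (hp _)).sub_const _
    -- The event depends on the error path alone, so equality of the laws of the whole processes
    -- transfers its probability.
    exact ((hεs j).measure_mem_eq (measurableSet_lt measurable_const hm)).symm
  refine ⟨fun T => ⋃ j ∈ (Finset.univ : Finset (Fin H)), ⋃ a ∈ Finset.range 3,
    ⋃ b ∈ Finset.range 3, V j a b T, ?_, fun T hT ω hω => ?_⟩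
  · refine tendsto_of_tendsto_of_tendsto_of_le_of_le tendsto_const_nhds
      (h := fun T => ∑ j : Fin H, ∑ a ∈ Finset.range 3, ∑ b ∈ Finset.range 3, μ (V j a b T))
      ?_ (fun T => zero_le) fun T => ?_
    · have := tendsto_finsetSum (Finset.univ : Finset (Fin H)) fun j _ =>
        tendsto_finsetSum (Finset.range 3) fun a _ =>
          tendsto_finsetSum (Finset.range 3) fun b _ => hV j a b
      simpa only [Finset.sum_const_zero] using this
    · refine (measure_biUnion_finset_le _ _).trans (Finset.sum_le_sum fun j _ => ?_)
      refine (measure_biUnion_finset_le _ _).trans (Finset.sum_le_sum fun a _ => ?_)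
      exact measure_biUnion_finset_le _ _
  · have hH0 : (0 : ℝ) < H := by exact_mod_cast hH
    have hpath : ∀ j, ContinuousOn (fun θ => rhoSimPath (εs j) T θ ω) (paramSpace κ) ∧
        ∀ θ ∈ paramSpace κ, |rhoSimPath (εs j) T θ ω - binding θ| ≤ 16 * c := fun j => by
      refine rhoSimPath_close hκ₀ hκ₁ hT (min_le_right _ _) fun a ha b hb => ?_
      by_contra hcon
      refine hω ?_
      simp only [mem_iUnion]
      exact ⟨j, Finset.mem_univ j, a, ha, b, hb, not_le.1 hcon⟩
    refine ⟨?_, fun θ hθ => ?_⟩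
    · exact continuousOn_const.mul (continuousOn_finsetSum _ fun j _ => (hpath j).1)
    · have e : rhoSim εs T θ ω - binding θ =
          1 / (H : ℝ) * ∑ j : Fin H, (rhoSimPath (εs j) T θ ω - binding θ) := by
        rw [rhoSim, Finset.sum_sub_distrib, Finset.sum_const, Finset.card_univ, Fintype.card_fin,
          nsmul_eq_mul]
        field_simp
      rw [e, abs_mul, abs_of_pos (by positivity : 0 < 1 / (H : ℝ)), one_div,
        inv_mul_le_iff₀ hH0]
      calc |∑ j : Fin H, (rhoSimPath (εs j) T θ ω - binding θ)|
          ≤ ∑ j : Fin H, 16 * c := (Finset.abs_sum_le_sum_abs _ _).trans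
            (Finset.sum_le_sum fun j _ => (hpath j).2 θ hθ)
        _ = H * (16 * c) := by simp
        _ ≤ H * η := by
          gcongr
          linarith [min_le_left (η / 16) (1 / 8)]

end Simulated

/-! ### Kernel mass and kernel decay -/

section Kernel

/-- The kernel weight of observation `t` at the rescaled time `u`. -/
noncomputable def kernelWeight (K : ℝ → ℝ) (h : ℕ → ℝ) (T : ℕ) (u : ℝ) (t : ℕ) : ℝ :=
  K ((u - (t : ℝ) / (T : ℝ)) / h T)

/-- The total kernel weight at the rescaled time `u`. -/
noncomputable def kernelMass (K : ℝ → ℝ) (h : ℕ → ℝ) (T : ℕ) (u : ℝ) : ℝ :=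
  ∑ t ∈ Finset.Icc 1 T, kernelWeight K h T u t

variable {K : ℝ → ℝ} {r : ℕ} {h : ℕ → ℝ} {m : ℕ → ℕ}

/-- The interval is taken strictly on one side of 0; by symmetry its mirror image serves as well, so
near either end of [0, 1] the side pointing inwards can be used. -/
theorem IsKernel.exists_pos_interval (hK : IsKernel K r) :
    ∃ p q k : ℝ, 0 < p ∧ p < q ∧ 0 < k ∧ ∀ x, p ≤ x → x ≤ q → k ≤ K x := by
  obtain ⟨x, hx, hKx⟩ : ∃ x, 0 < x ∧ 0 < K x := by
    by_contra! hcon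
    have hz : ∀ x, x ≠ 0 → K x = 0 := fun x hx => by
      rcases lt_or_gt_of_ne hx with hx | hx
      · rw [← hK.symm]
        exact le_antisymm (hcon _ (by linarith)) (hK.nonneg _)
      · exact le_antisymm (hcon _ hx) (hK.nonneg _)
    have h1 : ∫ x, K x = 0 := by
      refine integral_eq_zero_of_ae ?_
      filter_upwards [compl_mem_ae_iff.2 (measure_singleton (0 : ℝ))] with x hx
      exact hz x hx
    rw [hK.integral_eq_one] at h1
    exact one_ne_zero h1
  have hc : ContinuousAt K x := hK.contDiff.continuous.continuousAt
  have hev : ∀ᶠ y in 𝓝 x, K x / 2 < K y := hc.eventually (lt_mem_nhds (by linarith))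
  obtain ⟨d, hd, hball⟩ := Metric.eventually_nhds_iff.1 hev
  have hmin : 0 < min d x := lt_min hd hx
  refine ⟨x - min d x / 2, x, K x / 2, ?_, by linarith, by linarith, fun y h1 h2 => ?_⟩
  · linarith [min_le_right d x]
  · refine (hball ?_).le
    rw [Real.dist_eq, abs_lt]
    constructor <;> linarith [min_le_left d x]

theorem sub_sub_one_le_sum_of_mem {w : ℕ → ℝ} (hw : ∀ t, 0 ≤ w t) {k a b : ℝ} {T : ℕ}
    (hk : 0 ≤ k) (ha : 0 < a) (hb : b ≤ T) (hab : 0 ≤ b)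
    (hkw : ∀ t : ℕ, a ≤ t → (t : ℝ) ≤ b → k ≤ w t) :
    k * (b - a - 1) ≤ ∑ t ∈ Finset.Icc 1 T, w t := by
  have hsub : Finset.Icc ⌈a⌉₊ ⌊b⌋₊ ⊆ Finset.Icc 1 T := by
    refine Finset.Icc_subset_Icc (Nat.one_le_ceil_iff.2 ha) ?_
    exact_mod_cast (Nat.floor_le hab).trans hb
  have hcard : b - a - 1 ≤ (Finset.Icc ⌈a⌉₊ ⌊b⌋₊).card := by
    rw [Nat.card_Icc]
    have h1 := Nat.lt_floor_add_one b
    have h2 := Nat.ceil_lt_add_one ha.le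
    have h3 : ((⌊b⌋₊ + 1 : ℕ) : ℝ) - (⌈a⌉₊ : ℕ) ≤ ((⌊b⌋₊ + 1 - ⌈a⌉₊ : ℕ) : ℝ) := by
      rw [sub_le_iff_le_add]
      exact_mod_cast (by omega : ⌊b⌋₊ + 1 ≤ ⌊b⌋₊ + 1 - ⌈a⌉₊ + ⌈a⌉₊)
    push_cast at h3 ⊢
    linarith
  calc k * (b - a - 1) ≤ k * (Finset.Icc ⌈a⌉₊ ⌊b⌋₊).card := by gcongr
    _ = ∑ _t ∈ Finset.Icc ⌈a⌉₊ ⌊b⌋₊, k := by rw [Finset.sum_const, nsmul_eq_mul, mul_comm]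
    _ ≤ ∑ t ∈ Finset.Icc ⌈a⌉₊ ⌊b⌋₊, w t := Finset.sum_le_sum fun t ht => by
        obtain ⟨h1, h2⟩ := Finset.mem_Icc.1 ht
        exact hkw t (Nat.ceil_le.1 h1) ((Nat.le_floor_iff hab).1 h2)
    _ ≤ ∑ t ∈ Finset.Icc 1 T, w t := Finset.sum_le_sum_of_subset_of_nonneg hsub fun t _ _ => hw t

/-- The times t/T in a window of length (q - p)h beside u, on the side facing the centre, carry
weight at least k each. There are at least (q - p)Th - 1 of them, at least half of (q - p)Th once
this is at least 2. -/
theorem exists_kernelMass_ge (hK : IsKernel K r) (hh : IsBandwidth h m) :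
    ∃ c : ℝ, 0 < c ∧ ∀ᶠ T : ℕ in atTop, ∀ u ∈ Icc (0 : ℝ) 1,
      c * (T * h T) ≤ kernelMass K h T u := by
  obtain ⟨p, q, k, hp, hpq, hk, hKk⟩ := hK.exists_pos_interval
  have hqp : 0 < q - p := by linarith
  have hq1 : 0 < 2 * q + 1 := by linarith
  refine ⟨k * (q - p) / 2, by positivity, ?_⟩
  filter_upwards [eventually_gt_atTop 0, hh.tendsto_mul.eventually_ge_atTop (2 / (q - p)),
    hh.tendsto_zero.eventually (gt_mem_nhds (by positivity : 0 < 1 / (2 * q + 1)))]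
    with T hT0 hT1 hT2 u hu
  have hT : (0 : ℝ) < T := by exact_mod_cast hT0
  have hhT := hh.pos T
  rw [div_le_iff₀ hqp] at hT1
  rw [lt_div_iff₀ (by linarith)] at hT2
  have hw : ∀ t, 0 ≤ kernelWeight K h T u t := fun t => hK.nonneg _
  have hfin : k * (T * (q - p) * h T - 1) ≤ kernelMass K h T u := by
    rcases le_total u (1 / 2) with hu2 | hu2
    · have := sub_sub_one_le_sum_of_mem hw hk.le (a := T * (u + h T * p)) (b := T * (u + h T * q))
        (T := T) (mul_pos hT (add_pos_of_nonneg_of_pos hu.1 (mul_pos hhT hp)))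
        (mul_le_of_le_one_right hT.le (by nlinarith))
        (mul_nonneg hT.le (add_nonneg hu.1 (mul_nonneg hhT.le (by linarith))))
        fun t h1 h2 => by
          have e : (u - (t : ℝ) / T) / h T = -(((t : ℝ) / T - u) / h T) := by ring
          rw [kernelWeight, e, hK.symm]
          refine hKk _ ?_ ?_
          · rw [le_div_iff₀ hhT, le_sub_iff_add_le, le_div_iff₀ hT]
            linarith
          · rw [div_le_iff₀ hhT, sub_le_iff_le_add, div_le_iff₀ hT]
            linarith
      refine le_trans (le_of_eq ?_) this
      ring
    · have := sub_sub_one_le_sum_of_mem hw hk.le (a := T * (u - h T * q)) (b := T * (u - h T * p))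
        (T := T) (mul_pos hT (by nlinarith))
        (mul_le_of_le_one_right hT.le (by nlinarith [hu.2, mul_pos hhT hp]))
        (mul_nonneg hT.le (by nlinarith))
        fun t h1 h2 => by
          refine hKk _ ?_ ?_
          · rw [le_div_iff₀ hhT, le_sub_comm, div_le_iff₀ hT]
            linarith
          · rw [div_le_iff₀ hhT, sub_le_comm, le_div_iff₀ hT]
            linarith
      refine le_trans (le_of_eq ?_) this
      ring
  refine le_trans ?_ hfin
  calc k * (q - p) / 2 * (T * h T) = k * (T * h T * (q - p) / 2) := by ring
    _ ≤ k * (T * (q - p) * h T - 1) := by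
        gcongr
        linarith

/-- Kernel values far from the origin are negligible with respect to the bandwidth. -/
theorem eventually_kernel_far_le (hK : IsKernel K r) (hh : IsBandwidth h m) {η a : ℝ}
    (hη : 0 < η) (ha : 0 < a) :
    ∀ᶠ T : ℕ in atTop, ∀ x : ℝ, η < |x| → K (x / h T) ≤ a * h T := by
  have h1 : ∀ᶠ x in cocompact ℝ, |x| * K x < a * η :=
    hK.tendsto_zero.eventually (gt_mem_nhds (by positivity))
  rw [← Metric.cobounded_eq_cocompact, ← comap_norm_atTop, eventually_comap] at h1
  obtain ⟨R, hR⟩ := eventually_atTop.1 h1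
  filter_upwards [hh.tendsto_zero.eventually (gt_mem_nhds (by positivity : 0 < η / (|R| + 1)))]
    with T hT x hx
  have hhT := hh.pos T
  rw [lt_div_iff₀ (by positivity)] at hT
  have habs : |x / h T| = |x| / h T := by rw [abs_div, abs_of_pos hhT]
  have h2 : R ≤ |x / h T| := by
    rw [habs, le_div_iff₀ hhT]
    nlinarith [le_abs_self R]
  have h3 := hR _ h2 (x / h T) rfl
  rw [habs, div_mul_eq_mul_div, div_lt_iff₀ hhT] at h3
  have hx0 : 0 < |x| := hη.trans hx
  by_contra hcon
  nlinarith [mul_pos ha hhT, not_le.1 hcon]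

theorem abs_kernelWeight_sub_le {L : ℝ} (hL : ∀ x x', |K x - K x'| ≤ L * |x - x'|)
    (hh : IsBandwidth h m) (T t : ℕ) (u u' : ℝ) :
    |kernelWeight K h T u t - kernelWeight K h T u' t| ≤ L * (|u - u'| / h T) := by
  refine (hL _ _).trans_eq ?_
  rw [← sub_div, sub_sub_sub_cancel_right, abs_div, abs_of_pos (hh.pos T)]

end Kernel

/-! ### Uniform control of centred kernel averages -/

section UniformNoise

variable {Ω : Type*} {mΩ : MeasurableSpace Ω} {μ : Measure Ω} [IsProbabilityMeasure μ]
  {E : Type*} [MeasurableSpace E] {K : ℝ → ℝ} {r : ℕ} {h : ℕ → ℝ} {m : ℕ → ℕ}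

/-- Exponential bound for one kernel average. -/
theorem exists_kernel_average_tail {X : ℕ → ℕ → Ω → E} (hX : ∀ T t, Measurable (X T t))
    (hmix : IsPhiMixing μ X m) (hK : IsKernel K r) (hh : IsBandwidth h m)
    {f : ℕ → ℕ → E → ℝ} (hf : ∀ T t, Measurable (f T t))
    (hb : ∀ T, ∀ᵐ ω ∂μ, ∀ t ∈ Finset.Icc 1 T, |f T t (X T t ω)| ≤ 1)
    (hmean : ∀ T, ∀ t ∈ Finset.Icc 1 T, ∫ ω, f T t (X T t ω) ∂μ = 0)
    {a : ℝ} (ha : 0 < a) (ha1 : a ≤ 1) :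
    ∃ C : ℝ, 0 < C ∧ ∀ᶠ T : ℕ in atTop, ∀ u ∈ Icc (0 : ℝ) 1,
      μ {ω | a * kernelMass K h T u <
        |∑ t ∈ Finset.Icc 1 T, kernelWeight K h T u t * f T t (X T t ω)|} ≤
      ENNReal.ofReal (C / (T : ℝ) ^ 4) := by
  obtain ⟨c, hc, hmass⟩ := exists_kernelMass_ge hK hh
  obtain ⟨M₀, hM₀⟩ := hK.bounded
  set M := |M₀| + 1
  have hM : 0 < M := by positivity
  have hKM : ∀ x, K x ≤ M := fun x => (hM₀ x).trans (by linarith [le_abs_self M₀])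
  obtain ⟨R, hR⟩ := hmix.rate
  refine ⟨4 * Real.exp (6 * R), by positivity, ?_⟩
  filter_upwards [hmass, eventually_ge_atTop 2,
    hh.tendsto_div.eventually_ge_atTop (64 * M / (c * a ^ 2))] with T hT hT2 hTd u hu
  have hT1 : 1 ≤ T := by omega
  have hT0 : (0 : ℝ) < T := by exact_mod_cast hT1
  have hhT := hh.pos T
  have hm := hmix.one_le T hT1
  have hm0 : (0 : ℝ) < m T := by exact_mod_cast hm
  have hlog : 0 < Real.log T := Real.log_pos (by exact_mod_cast hT2)
  set W := kernelMass K h T u with hW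
  have hWc : c * (T * h T) ≤ W := hT u hu
  have hW0 : 0 < W := lt_of_lt_of_le (by positivity) hWc
  -- An upper bound for the normalized weight of one block. The exponent a² / (16β) is of order Th /
  -- m_T, so the bandwidth condition makes it exceed 4 log T; the mixing rate bounds the remaining
  -- term by 6R.
  set β := m T * M / (c * (T * h T)) with hβ
  have hβ0 : 0 < β := by positivity
  have htail := measure_abs_weighted_sum_gt_le (μ := μ) hX hm (hf T)
    (v := fun t => kernelWeight K h T u t / W)
    (fun t => div_nonneg (hK.nonneg _) hW0.le)
    (by rw [← Finset.sum_div]; exact (div_self hW0.ne').le) hβ0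
    (fun t _ => by
      rw [mul_div_assoc', hβ]
      gcongr
      exact hKM _) (hb T) (hmean T) ha ha1
  have hset : {ω | a * W < |∑ t ∈ Finset.Icc 1 T, kernelWeight K h T u t * f T t (X T t ω)|} =
      {ω | a < |∑ t ∈ Finset.Icc 1 T, kernelWeight K h T u t / W * f T t (X T t ω)|} := by
    ext ω
    have e : ∑ t ∈ Finset.Icc 1 T, kernelWeight K h T u t / W * f T t (X T t ω) =
        (∑ t ∈ Finset.Icc 1 T, kernelWeight K h T u t * f T t (X T t ω)) / W := by
      rw [Finset.sum_div]
      exact Finset.sum_congr rfl fun t _ => by ring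
    rw [mem_ofPred_eq, mem_ofPred_eq, e, abs_div, abs_of_pos hW0, lt_div_iff₀ hW0]
  rw [hset]
  refine htail.trans ?_
  have h4 : (4 : ℝ≥0∞) = ENNReal.ofReal 4 := by simp
  rw [h4, ← ENNReal.ofReal_mul (by norm_num)]
  refine ENNReal.ofReal_le_ofReal ?_
  rw [mul_div_assoc]
  gcongr
  have hexp : (T : ℝ) ^ 4 = Real.exp (4 * Real.log T) := by
    rw [mul_comm, Real.exp_mul, Real.exp_log hT0]
    norm_num
  rw [hexp, ← Real.exp_sub]
  refine Real.exp_le_exp.2 ?_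
  have h5 : 3 * phiMix μ X (m T) * (T / m T + 1 : ℕ) ≤ 6 * R := by
    have h6 : ((T / m T + 1 : ℕ) : ℝ) ≤ 2 * (T / m T) := by
      have h7 : ((T / m T : ℕ) : ℝ) ≤ T / m T := Nat.cast_div_le
      have h8 : 1 ≤ (T : ℝ) / m T :=
        (one_le_div hm0).2 (by exact_mod_cast hmix.le_self T hT1)
      push_cast
      linarith
    calc 3 * phiMix μ X (m T) * (T / m T + 1 : ℕ)
        ≤ 3 * phiMix μ X (m T) * (2 * (T / m T)) := by
          gcongr
          exact mul_nonneg (by norm_num) (phiMix_nonneg X _)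
      _ = 6 * (T * phiMix μ X (m T) / m T) := by ring
      _ ≤ 6 * R := by linarith [hR T hT1]
  have h9 : 4 * Real.log T ≤ a ^ 2 / (16 * β) := by
    rw [div_le_div_iff₀ (by positivity) (by positivity)] at hTd
    rw [hβ, le_div_iff₀ (by positivity)]
    have : 4 * Real.log T * (16 * (m T * M / (c * (T * h T)))) =
        64 * M * (m T * Real.log T) / (c * (T * h T)) := by
      field_simp
      ring
    rw [this, div_le_iff₀ (by positivity)]
    linarith
  rw [neg_div]
  linarith

/-- Uniform law of large numbers for kernel averages of bounded mixing variables. -/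
theorem exists_kernel_average_uniform {X : ℕ → ℕ → Ω → E} (hX : ∀ T t, Measurable (X T t))
    (hmix : IsPhiMixing μ X m) (hK : IsKernel K r) (hh : IsBandwidth h m)
    {f : ℕ → ℕ → E → ℝ} (hf : ∀ T t, Measurable (f T t))
    (hb : ∀ T, ∀ᵐ ω ∂μ, ∀ t ∈ Finset.Icc 1 T, |f T t (X T t ω)| ≤ 1)
    (hmean : ∀ T, ∀ t ∈ Finset.Icc 1 T, ∫ ω, f T t (X T t ω) ∂μ = 0)
    {a : ℝ} (ha : 0 < a) :
    ∃ S : ℕ → Set Ω, Tendsto (fun T => μ (S T)) atTop (𝓝 0) ∧ ∀ᶠ T : ℕ in atTop, ∀ ω ∉ S T,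
      ∀ u ∈ Icc (0 : ℝ) 1,
        |∑ t ∈ Finset.Icc 1 T, kernelWeight K h T u t * f T t (X T t ω)| ≤
          a * kernelMass K h T u := by
  wlog ha1 : a ≤ 1 generalizing a
  · obtain ⟨S, hS, hS'⟩ := this one_pos le_rfl
    refine ⟨S, hS, ?_⟩
    filter_upwards [hS'] with T hT ω hω u hu
    refine (hT ω hω u hu).trans ?_
    have : 0 ≤ kernelMass K h T u := Finset.sum_nonneg fun t _ => hK.nonneg _
    gcongr
    exact (not_le.1 ha1).le
  obtain ⟨C, hC, htail⟩ := exists_kernel_average_tail hX hmix hK hh hf hb hmean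
    (half_pos ha) (by linarith)
  obtain ⟨c, hc, hmass⟩ := exists_kernelMass_ge hK hh
  obtain ⟨L₀, hL₀⟩ := hK.lipschitz
  set L := |L₀| + 1
  have hL0 : 0 < L := by positivity
  have hL : ∀ x x', |K x - K x'| ≤ L * |x - x'| := fun x x' =>
    (hL₀ x x').trans (by gcongr; linarith [le_abs_self L₀])
  set V : ℕ → ℝ → Set Ω := fun T u => {ω | a / 2 * kernelMass K h T u <
    |∑ t ∈ Finset.Icc 1 T, kernelWeight K h T u t * f T t (X T t ω)|}
  set Z : ℕ → Set Ω := fun T => {ω | ¬ ∀ t ∈ Finset.Icc 1 T, |f T t (X T t ω)| ≤ 1}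
  have hZ : ∀ T, μ (Z T) = 0 := fun T => ae_iff.1 (hb T)
  -- A grid of mesh T⁻³: its T³ + 1 points, each with tail O(T⁻⁴), have total probability O(1/T).
  set g : ℕ → ℕ → ℝ := fun T i => (i : ℝ) / (T : ℝ) ^ 3 with hg
  refine ⟨fun T => Z T ∪ ⋃ i ∈ Finset.range (T ^ 3 + 1), V T (g T i), ?_, ?_⟩
  · have hlim : Tendsto (fun T : ℕ => ENNReal.ofReal (2 * C / (T : ℝ))) atTop (𝓝 0) := by
      rw [← ENNReal.ofReal_zero]
      exact ENNReal.tendsto_ofReal (tendsto_const_div_atTop_nhds_zero_nat _)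
    refine tendsto_of_tendsto_of_tendsto_of_le_of_le' tendsto_const_nhds hlim
      (Eventually.of_forall fun T => zero_le) ?_
    filter_upwards [htail, eventually_gt_atTop 0] with T hT hT0
    have hT0' : (1 : ℝ) ≤ T := by exact_mod_cast hT0
    refine (measure_union_le _ _).trans ?_
    rw [hZ, zero_add]
    refine (measure_biUnion_finset_le _ _).trans ?_
    calc ∑ i ∈ Finset.range (T ^ 3 + 1), μ (V T (g T i))
        ≤ ∑ i ∈ Finset.range (T ^ 3 + 1), ENNReal.ofReal (C / (T : ℝ) ^ 4) := by
          refine Finset.sum_le_sum fun i hi => hT _ ⟨by positivity, ?_⟩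
          have : (i : ℝ) ≤ (T : ℝ) ^ 3 := by
            exact_mod_cast Nat.lt_succ_iff.1 (Finset.mem_range.1 hi)
          exact div_le_one_of_le₀ this (by positivity)
      _ = ENNReal.ofReal (((T ^ 3 + 1 : ℕ) : ℝ) * (C / (T : ℝ) ^ 4)) := by
          rw [Finset.sum_const, Finset.card_range, nsmul_eq_mul,
            ENNReal.ofReal_mul (by positivity), ENNReal.ofReal_natCast]
      _ ≤ ENNReal.ofReal (2 * C / (T : ℝ)) := by
          refine ENNReal.ofReal_le_ofReal ?_
          have h1 : ((T ^ 3 + 1 : ℕ) : ℝ) ≤ 2 * (T : ℝ) ^ 3 := by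
            push_cast
            linarith [one_le_pow₀ (n := 3) hT0']
          calc ((T ^ 3 + 1 : ℕ) : ℝ) * (C / (T : ℝ) ^ 4)
              ≤ 2 * (T : ℝ) ^ 3 * (C / (T : ℝ) ^ 4) := by gcongr
            _ = 2 * C / (T : ℝ) := by field_simp
  · obtain ⟨N, hN⟩ := exists_nat_ge (4 * L / (c * a))
    filter_upwards [hmass, eventually_ge_atTop (max N 1), hh.tendsto_mul.eventually_ge_atTop 1]
      with T hT hTN hTh ω hω u hu
    have hT1 : (1 : ℝ) ≤ T := by exact_mod_cast (le_max_right N 1).trans hTN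
    have hT0 : (0 : ℝ) < T := by linarith
    have hTN' : 4 * L ≤ T * (c * a) := by
      rw [div_le_iff₀ (by positivity)] at hN
      refine hN.trans ?_
      gcongr
      exact_mod_cast (le_max_left N 1).trans hTN
    have hhT := hh.pos T
    have hT3 : (0 : ℝ) < (T : ℝ) ^ 3 := by positivity
    simp only [mem_union, mem_iUnion, not_or, not_exists] at hω
    obtain ⟨hω1, hω2⟩ := hω
    have hf1 : ∀ t ∈ Finset.Icc 1 T, |f T t (X T t ω)| ≤ 1 := not_not.1 hω1
    set i := ⌊u * (T : ℝ) ^ 3⌋₊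
    have hi1 : (i : ℝ) ≤ u * (T : ℝ) ^ 3 := Nat.floor_le (mul_nonneg hu.1 hT3.le)
    have hi2 : u * (T : ℝ) ^ 3 < i + 1 := Nat.lt_floor_add_one _
    have hirange : i ∈ Finset.range (T ^ 3 + 1) := by
      rw [Finset.mem_range, Nat.lt_succ_iff]
      have : (i : ℝ) ≤ (T : ℝ) ^ 3 := hi1.trans (mul_le_of_le_one_left hT3.le hu.2)
      exact_mod_cast this
    have hgrid : |∑ t ∈ Finset.Icc 1 T, kernelWeight K h T (g T i) t * f T t (X T t ω)| ≤
        a / 2 * kernelMass K h T (g T i) := not_lt.1 (hω2 i hirange)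
    have hdist : |u - g T i| ≤ 1 / (T : ℝ) ^ 3 := by
      have h1 : g T i ≤ u := by rw [hg]; exact (div_le_iff₀ hT3).2 hi1
      rw [abs_of_nonneg (sub_nonneg.2 h1), sub_le_iff_le_add, hg]
      simp only
      rw [← add_div, le_div_iff₀ hT3]
      linarith
    set e := L * (1 / (T : ℝ) ^ 3 / h T)
    have he : ∀ t, |kernelWeight K h T u t - kernelWeight K h T (g T i) t| ≤ e := fun t =>
      (abs_kernelWeight_sub_le hL hh T t u (g T i)).trans
        (mul_le_mul_of_nonneg_left (div_le_div_of_nonneg_right hdist hhT.le) hL0.le)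
    have hsumconst : ∑ _t ∈ Finset.Icc 1 T, e = T * e := by simp
    -- Passing to the nearest grid point below changes the sum by at most L / (T² h), negligible
    -- against the kernel mass since Th ≥ 1 and T is large.
    have hTe : T * e ≤ c * (T * h T) * a / 4 := by
      have h1 : T * e = L / ((T : ℝ) ^ 2 * h T) := by
        simp only [e]
        field_simp
      rw [h1, div_le_iff₀ (by positivity)]
      have h2 : 1 ≤ ((T : ℝ) * h T) ^ 2 := one_le_pow₀ hTh
      calc L ≤ T * (c * a) / 4 * 1 := by linarith
        _ ≤ T * (c * a) / 4 * (T * h T) ^ 2 := by gcongr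
        _ = c * (T * h T) * a / 4 * (T ^ 2 * h T) := by ring
    have hd1 : |∑ t ∈ Finset.Icc 1 T, kernelWeight K h T u t * f T t (X T t ω) -
        ∑ t ∈ Finset.Icc 1 T, kernelWeight K h T (g T i) t * f T t (X T t ω)| ≤ T * e := by
      rw [← Finset.sum_sub_distrib, ← hsumconst]
      refine (Finset.abs_sum_le_sum_abs _ _).trans (Finset.sum_le_sum fun t ht => ?_)
      rw [← sub_mul, abs_mul]
      exact (mul_le_of_le_one_right (abs_nonneg _) (hf1 t ht)).trans (he t)
    have hd2 : kernelMass K h T (g T i) ≤ kernelMass K h T u + T * e := by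
      rw [kernelMass, kernelMass, ← hsumconst, ← Finset.sum_add_distrib]
      refine Finset.sum_le_sum fun t _ => ?_
      linarith [(abs_le.1 (he t)).1]
    have hWu := hT u hu
    have h5 : |∑ t ∈ Finset.Icc 1 T, kernelWeight K h T u t * f T t (X T t ω)| ≤
        a / 2 * kernelMass K h T (g T i) + T * e := by
      have := abs_sub_abs_le_abs_sub
        (∑ t ∈ Finset.Icc 1 T, kernelWeight K h T u t * f T t (X T t ω))
        (∑ t ∈ Finset.Icc 1 T, kernelWeight K h T (g T i) t * f T t (X T t ω))
      linarith
    have h6 : 0 ≤ T * e := by positivity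
    nlinarith

end UniformNoise

/-! ### The deterministic bias -/

section Bias

variable {θ₀ : ℝ → ℝ} {κ : ℝ} {K : ℝ → ℝ} {r : ℕ} {h : ℕ → ℝ} {m : ℕ → ℕ}

/-- On an interval of length 1, a bounded second derivative bounds the first by comparison with its
value at 1/2. -/
theorem BoundedSecondDeriv.exists_lipschitz (hθ : BoundedSecondDeriv θ₀ (Ioo 0 1)) :
    ∃ L : ℝ, 0 < L ∧ ∀ x ∈ Ioo (0 : ℝ) 1, ∀ y ∈ Ioo (0 : ℝ) 1, |θ₀ x - θ₀ y| ≤ L * |x - y| := by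
  obtain ⟨hd, C, hC⟩ := hθ
  have hhalf : (1 / 2 : ℝ) ∈ Ioo (0 : ℝ) 1 := by constructor <;> norm_num
  have hC0 : 0 ≤ C := (abs_nonneg _).trans (hC _ hhalf)
  have h1 : ∀ x ∈ Ioo (0 : ℝ) 1, ‖deriv θ₀ x‖ ≤ |deriv θ₀ (1 / 2)| + C + 1 := fun x hx => by
    have h2 := (convex_Ioo (0 : ℝ) 1).norm_image_sub_le_of_norm_deriv_le (f := deriv θ₀)
      (fun x hx => (hd x hx).2) hC hhalf hx
    have h3 : ‖x - 1 / 2‖ ≤ 1 := by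
      rw [Real.norm_eq_abs, abs_le]
      constructor <;> linarith [hx.1, hx.2]
    have h4 : |deriv θ₀ x| - |deriv θ₀ (1 / 2)| ≤ C :=
      (abs_sub_abs_le_abs_sub _ _).trans (h2.trans (mul_le_of_le_one_right hC0 h3))
    rw [Real.norm_eq_abs]
    linarith
  refine ⟨|deriv θ₀ (1 / 2)| + C + 1, by positivity, fun x hx y hy => ?_⟩
  exact (convex_Ioo (0 : ℝ) 1).norm_image_sub_le_of_norm_deriv_le
    (fun x hx => (hd x hx).1) h1 hy hx

/-- The parameter constraint is available only on the open interval; the times t = 0 and t = T use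
the two fixed, otherwise arbitrary, values at the endpoints. -/
theorem abs_structural_le (hκ₀ : 0 < κ) (hθ₀mem : ∀ u ∈ Ioo (0 : ℝ) 1, θ₀ u ∈ paramSpace κ)
    {t T : ℕ} (hT : 1 ≤ T) (ht : t ≤ T) :
    |θ₀ ((t : ℝ) / T)| ≤ 1 + |θ₀ 0| + |θ₀ 1| := by
  have h0 := abs_nonneg (θ₀ 0)
  have h1 := abs_nonneg (θ₀ 1)
  rcases Nat.eq_zero_or_pos t with rfl | ht0
  · simp only [Nat.cast_zero, zero_div]
    linarith
  rcases eq_or_lt_of_le ht with rfl | ht1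
  · rw [div_self (by positivity)]
    linarith
  · have := abs_le_of_mem_paramSpace (hθ₀mem _ (div_mem_Ioo ht0 ht1))
    linarith

/-- The kernel average of the mean of the estimating function is uniformly negligible. -/
theorem eventually_bias_le (hκ₀ : 0 < κ) (hθ₀ : BoundedSecondDeriv θ₀ (Ioo 0 1))
    (hθ₀mem : ∀ u ∈ Ioo (0 : ℝ) 1, θ₀ u ∈ paramSpace κ) (hK : IsKernel K r)
    (hh : IsBandwidth h m) {a : ℝ} (ha : 0 < a) :
    ∀ᶠ T : ℕ in atTop, ∀ u ∈ Ioo (0 : ℝ) 1,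
      |∑ t ∈ Finset.Icc 1 T, kernelWeight K h T u t * (θ₀ ((t : ℝ) / T) -
        binding (θ₀ u) * (1 + θ₀ (((t - 1 : ℕ) : ℝ) / T) ^ 2))| ≤ a * kernelMass K h T u := by
  obtain ⟨L, hL0, hL⟩ := hθ₀.exists_lipschitz
  obtain ⟨c, hc, hmass⟩ := exists_kernelMass_ge hK hh
  obtain ⟨M₀, hM₀⟩ := hK.bounded
  set M := |M₀| + 1
  have hM : 0 < M := by positivity
  have hKM : ∀ x, K x ≤ M := fun x => (hM₀ x).trans (by linarith [le_abs_self M₀])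
  set Q := 1 + |θ₀ 0| + |θ₀ 1|
  have hQ1 : 1 ≤ Q := by
    have h0 := abs_nonneg (θ₀ 0)
    have h1 := abs_nonneg (θ₀ 1)
    linarith
  set G := Q + 1 / 2 * (1 + Q ^ 2)
  have hG : 0 < G := by positivity
  set η := a / (8 * L)
  have hη : 0 < η := by positivity
  obtain ⟨N, hN⟩ := exists_nat_ge (4 * L / a)
  filter_upwards [hmass, eventually_kernel_far_le hK hh hη
      (by positivity : 0 < a * c / (4 * G)), eventually_ge_atTop (max N 1),
      hh.tendsto_mul.eventually_ge_atTop (8 * (G * M) / (a * c))] with T hT hfar hTN hTh u hu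
  have hT1 : 1 ≤ T := (le_max_right N 1).trans hTN
  have hT0 : (0 : ℝ) < T := by exact_mod_cast hT1
  have hLT : L / T ≤ a / 4 := by
    have h1 : (N : ℝ) ≤ T := by exact_mod_cast (le_max_left N 1).trans hTN
    rw [div_le_iff₀ ha] at hN
    rw [div_le_iff₀ hT0]
    nlinarith
  have hhT := hh.pos T
  have hW := hT u ⟨hu.1.le, hu.2.le⟩
  rw [div_le_iff₀ (by positivity)] at hTh
  set g : ℕ → ℝ := fun t => θ₀ ((t : ℝ) / T) -
        binding (θ₀ u) * (1 + θ₀ (((t - 1 : ℕ) : ℝ) / T) ^ 2) with hg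
  have hgG : ∀ t ∈ Finset.Icc 1 T, |g t| ≤ G := fun t ht => by
    have htT := (Finset.mem_Icc.1 ht).2
    have h1 := abs_structural_le hκ₀ hθ₀mem hT1 htT
    have h2 := abs_structural_le hκ₀ hθ₀mem hT1 ((Nat.sub_le t 1).trans htT)
    refine (abs_sub _ _).trans (add_le_add h1 ?_)
    rw [abs_mul, abs_of_nonneg (by positivity : 0 ≤ 1 + θ₀ (((t - 1 : ℕ) : ℝ) / T) ^ 2), ← sq_abs]
    gcongr
    exact abs_binding_le _
  have hnear : ∀ t : ℕ, 2 ≤ t → t < T → |u - (t : ℝ) / T| ≤ η → |g t| ≤ 2 * L * η + L / T := by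
    intro t ht2 htT hdist
    have m1 := div_mem_Ioo (by omega : 1 ≤ t) htT
    have m2 := div_mem_Ioo (by omega : 1 ≤ t - 1) (by omega : t - 1 < T)
    -- Subtracts the identity `binding (θ₀ u) * (1 + θ₀ u ^ 2) = θ₀ u`, which leaves only increments
    -- of θ₀.
    have e : g t = (θ₀ ((t : ℝ) / T) - θ₀ u) +
        binding (θ₀ u) * ((θ₀ u + θ₀ (((t - 1 : ℕ) : ℝ) / T)) *
          (θ₀ u - θ₀ (((t - 1 : ℕ) : ℝ) / T))) := by
      have : binding (θ₀ u) * (1 + θ₀ u ^ 2) = θ₀ u := div_mul_cancel₀ _ (by positivity)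
      simp only [hg]
      linear_combination -this
    have h1 : |θ₀ ((t : ℝ) / T) - θ₀ u| ≤ L * η := by
      rw [abs_sub_comm]
      refine (hL u hu _ m1).trans ?_
      gcongr
    have h2 : |θ₀ u - θ₀ (((t - 1 : ℕ) : ℝ) / T)| ≤ L * (η + 1 / T) := by
      refine (hL u hu _ m2).trans ?_
      gcongr
      have : u - ((t - 1 : ℕ) : ℝ) / T = (u - (t : ℝ) / T) + 1 / T := by
        rw [Nat.cast_sub (by omega), Nat.cast_one]
        ring
      rw [this]
      refine (abs_add_le _ _).trans (add_le_add hdist ?_)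
      rw [abs_of_pos (by positivity)]
    have h3 : |θ₀ u + θ₀ (((t - 1 : ℕ) : ℝ) / T)| ≤ 2 := by
      have b1 := abs_le_of_mem_paramSpace (hθ₀mem u hu)
      have b2 := abs_le_of_mem_paramSpace (hθ₀mem _ m2)
      refine (abs_add_le _ _).trans (by linarith)
    rw [e]
    refine (abs_add_le _ _).trans ?_
    rw [abs_mul, abs_mul]
    calc _ ≤ L * η + 1 / 2 * (2 * (L * (η + 1 / T))) := by
          gcongr
          exact abs_binding_le _
      _ = 2 * L * η + L / T := by ring
  -- Near times, far times and the two end indices contribute a/2, a/4 and a/4 of the kernel mass.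
  -- The indices t = 1 and t = T are set apart because they involve `θ₀ 0` and `θ₀ 1`.
  have hterm : ∀ t ∈ Finset.Icc 1 T, |kernelWeight K h T u t * g t| ≤
      (a / 2) * kernelWeight K h T u t + G * (a * c / (4 * G) * h T) +
        ((if t = 1 then G * M else 0) + (if t = T then G * M else 0)) := by
    intro t ht
    have hw0 : 0 ≤ kernelWeight K h T u t := hK.nonneg _
    have hGM : 0 < G * M := by positivity
    have i1 : 0 ≤ (if t = 1 then G * M else 0) := by split_ifs <;> simp [hGM.le]
    have i2 : 0 ≤ (if t = T then G * M else 0) := by split_ifs <;> simp [hGM.le]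
    have p1 : 0 ≤ (a / 2) * kernelWeight K h T u t := by positivity
    have p2 : 0 ≤ G * (a * c / (4 * G) * h T) := by positivity
    have hGw : |kernelWeight K h T u t * g t| ≤ G * kernelWeight K h T u t := by
      rw [abs_mul, abs_of_nonneg hw0, mul_comm]
      exact mul_le_mul_of_nonneg_right (hgG t ht) hw0
    have hwM : G * kernelWeight K h T u t ≤ G * M := mul_le_mul_of_nonneg_left (hKM _) hG.le
    by_cases t1 : t = 1
    · rw [if_pos t1] at i1 ⊢
      linarith
    by_cases t2 : t = T
    · rw [if_pos t2] at i2 ⊢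
      linarith
    have htI := Finset.mem_Icc.1 ht
    by_cases hd : |u - (t : ℝ) / T| ≤ η
    · have h1 := hnear t (by omega) (by omega) hd
      have h2 : 2 * L * η + L / T ≤ a / 2 := by
        have : 2 * L * η = a / 4 := by simp only [η]; field_simp; ring
        linarith
      have h3 : |kernelWeight K h T u t * g t| ≤ (a / 2) * kernelWeight K h T u t := by
        rw [abs_mul, abs_of_nonneg hw0, mul_comm]
        exact mul_le_mul_of_nonneg_right (h1.trans h2) hw0
      linarith
    · have h1 : kernelWeight K h T u t ≤ a * c / (4 * G) * h T := hfar _ (not_le.1 hd)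
      have h2 := mul_le_mul_of_nonneg_left h1 hG.le
      linarith
  calc |∑ t ∈ Finset.Icc 1 T, kernelWeight K h T u t * g t|
      ≤ ∑ t ∈ Finset.Icc 1 T, ((a / 2) * kernelWeight K h T u t + G * (a * c / (4 * G) * h T) +
        ((if t = 1 then G * M else 0) + (if t = T then G * M else 0))) :=
        (Finset.abs_sum_le_sum_abs _ _).trans (Finset.sum_le_sum hterm)
    _ = a / 2 * kernelMass K h T u + T * (G * (a * c / (4 * G) * h T)) + (G * M + G * M) := by
        rw [Finset.sum_add_distrib, Finset.sum_add_distrib, Finset.sum_add_distrib,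
          Finset.sum_ite_eq', Finset.sum_ite_eq', if_pos (Finset.mem_Icc.2 ⟨le_rfl, hT1⟩),
          if_pos (Finset.mem_Icc.2 ⟨hT1, le_rfl⟩), ← Finset.mul_sum]
        simp [kernelMass]
    _ ≤ a * kernelMass K h T u := by
        have e : T * (G * (a * c / (4 * G) * h T)) = a / 4 * (c * (T * h T)) := by
          field_simp
        rw [e]
        nlinarith

end Bias

/-! ### Uniform consistency of the kernel estimator -/

section KernelEstimator

variable {Ω : Type*} {mΩ : MeasurableSpace Ω} {μ : Measure Ω}
  {ε : ℤ → Ω → ℝ} {κ : ℝ} {θ₀ : ℝ → ℝ} {K : ℝ → ℝ} {r : ℕ} {h : ℕ → ℝ} {m : ℕ → ℕ}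

theorem integral_noise_mul (hε : IsWhiteNoise μ ε) (i j : ℤ) :
    ∫ ω, ε i ω * ε j ω ∂μ = if i = j then 1 else 0 := by
  by_cases hij : i = j
  · subst hij
    have := hε.unit_variance i
    simp only [sq] at this
    simpa using this
  · rw [if_neg hij, hε.uncorrelated i j hij]

variable [IsProbabilityMeasure μ]

/-- The time indices are compared in ℤ: truncated subtraction would give false coincidences at time
0. -/
theorem integral_obs_mul (hε : IsWhiteNoise μ ε) {B : ℝ}
    (hB : ∀ᵐ ω ∂μ, ∀ t : ℤ, |ε t ω| ≤ B) (T s t : ℕ) :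
    ∫ ω, obs ε θ₀ T s ω * obs ε θ₀ T t ω ∂μ =
      (if (s : ℤ) = t then 1 else 0) + θ₀ ((t : ℝ) / T) * (if (s : ℤ) = t - 1 then 1 else 0) +
      θ₀ ((s : ℝ) / T) * (if (s : ℤ) - 1 = t then 1 else 0) +
      θ₀ ((s : ℝ) / T) * θ₀ ((t : ℝ) / T) * (if (s : ℤ) - 1 = t - 1 then 1 else 0) := by
  have hint : ∀ i j : ℤ, Integrable (fun ω => ε i ω * ε j ω) μ := fun i j => by
    refine Integrable.of_bound ((hε.measurable _).mul (hε.measurable _)).aestronglyMeasurable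
      (B * B) ?_
    filter_upwards [hB] with ω h
    rw [norm_mul]
    exact mul_le_mul (h _) (h _) (norm_nonneg _) ((abs_nonneg _).trans (h 0))
  have e : (fun ω => obs ε θ₀ T s ω * obs ε θ₀ T t ω) = fun ω =>
      ε s ω * ε t ω + θ₀ ((t : ℝ) / T) * (ε s ω * ε (t - 1) ω) +
      θ₀ ((s : ℝ) / T) * (ε (s - 1) ω * ε t ω) +
      θ₀ ((s : ℝ) / T) * θ₀ ((t : ℝ) / T) * (ε (s - 1) ω * ε (t - 1) ω) := by
    ext ω
    simp only [obs]
    ring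
  have i1 : Integrable (fun ω => ε s ω * ε t ω + θ₀ ((t : ℝ) / T) * (ε s ω * ε (t - 1) ω)) μ :=
    (hint _ _).add ((hint _ _).const_mul _)
  have i2 : Integrable (fun ω => ε s ω * ε t ω + θ₀ ((t : ℝ) / T) * (ε s ω * ε (t - 1) ω) +
      θ₀ ((s : ℝ) / T) * (ε (s - 1) ω * ε t ω)) μ := i1.add ((hint _ _).const_mul _)
  rw [e, integral_add i2 ((hint _ _).const_mul _), integral_add i1 ((hint _ _).const_mul _),
    integral_add (hint _ _) ((hint _ _).const_mul _), integral_const_mul, integral_const_mul,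
    integral_const_mul, integral_noise_mul hε, integral_noise_mul hε, integral_noise_mul hε,
    integral_noise_mul hε]

/-- Uniform consistency of the kernel estimator of the auxiliary parameter. -/
theorem exists_rhoHat_close (hε : IsWhiteNoise μ ε) (hκ₀ : 0 < κ)
    (hθ₀ : BoundedSecondDeriv θ₀ (Ioo 0 1))
    (hθ₀mem : ∀ u ∈ Ioo (0 : ℝ) 1, θ₀ u ∈ paramSpace κ) {B : ℝ} (hB1 : 1 ≤ B)
    (hB : ∀ᵐ ω ∂μ, ∀ t : ℤ, |ε t ω| ≤ B) (hmix : IsPhiMixing μ (obsPair ε θ₀) m)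
    (hK : IsKernel K r) (hh : IsBandwidth h m) {η : ℝ} (hη : 0 < η) :
    ∃ S : ℕ → Set Ω, Tendsto (fun T => μ (S T)) atTop (𝓝 0) ∧ ∀ᶠ T : ℕ in atTop, ∀ ω ∉ S T,
      ∀ u ∈ Ioo (0 : ℝ) 1, |rhoHat (obs ε θ₀) K h T u ω - binding (θ₀ u)| ≤ η := by
  have hm := measurable_obsPair (θ₀ := θ₀) hε.measurable
  set Q := 1 + |θ₀ 0| + |θ₀ 1|
  have hQ1 : 1 ≤ Q := by
    have h0 := abs_nonneg (θ₀ 0)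
    have h1 := abs_nonneg (θ₀ 1)
    linarith
  set A := 2 * (Q * B)
  have hA1 : 1 ≤ A := by nlinarith
  have hobs : ∀ {ω : Ω}, (∀ t : ℤ, |ε t ω| ≤ B) → ∀ {T t : ℕ}, 1 ≤ T → t ≤ T →
      |obs ε θ₀ T t ω| ≤ A := by
    intro ω hω T t hT ht
    have h1 := abs_structural_le hκ₀ hθ₀mem hT ht
    calc |obs ε θ₀ T t ω| ≤ |ε t ω| + |θ₀ ((t : ℝ) / T)| * |ε (t - 1) ω| := by
          rw [← abs_mul]; exact abs_add_le _ _
      _ ≤ B + Q * B := by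
          gcongr
          · exact hω _
          · exact hω _
      _ ≤ A := by simp only [A]; nlinarith
  -- Normalizes the centred products to absolute value at most 1.
  set V := A ^ 2 + 1 + Q ^ 2
  have hV : 0 < V := by positivity
  have hVb : ∀ y z e : ℝ, |y| ≤ A → |z| ≤ A → |e| ≤ 1 + Q ^ 2 → |(z * y - e) / V| ≤ 1 := by
    intro y z e hy hz he
    rw [abs_div, abs_of_pos hV, div_le_one hV]
    refine (abs_sub _ _).trans ?_
    rw [abs_mul]
    have : |z| * |y| ≤ A * A := mul_le_mul hz hy (abs_nonneg _) (by linarith)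
    linarith [sq A]
  have hcross : ∀ T, ∀ t ∈ Finset.Icc 1 T,
      ∫ ω, obs ε θ₀ T (t - 1) ω * obs ε θ₀ T t ω ∂μ = θ₀ ((t : ℝ) / T) := by
    intro T t ht
    have := (Finset.mem_Icc.1 ht).1
    rw [integral_obs_mul hε hB, if_neg (by omega), if_pos (by omega), if_neg (by omega),
      if_neg (by omega)]
    ring
  have hsquare : ∀ T s,
      ∫ ω, obs ε θ₀ T s ω * obs ε θ₀ T s ω ∂μ = 1 + θ₀ ((s : ℝ) / T) ^ 2 := by
    intro T s
    rw [integral_obs_mul hε hB, if_pos rfl, if_neg (by omega), if_neg (by omega), if_pos rfl]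
    ring
  have hobsi : ∀ T, ∀ s ≤ T, ∀ t ≤ T, 1 ≤ T →
      Integrable (fun ω => obs ε θ₀ T s ω * obs ε θ₀ T t ω) μ := by
    intro T s hs t ht hT
    refine Integrable.of_bound ((measurable_obs hε.measurable T s).mul
      (measurable_obs hε.measurable T t)).aestronglyMeasurable (A * A) ?_
    filter_upwards [hB] with ω hω
    rw [norm_mul]
    exact mul_le_mul (hobs hω hT hs) (hobs hω hT ht) (norm_nonneg _) (by linarith)
  -- The first entry keeps the denominator above half the kernel mass; the second turns the
  -- numerator error (2V + 1)a into η after division by that half.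
  set a := min (1 / (2 * V)) (η / (2 * (2 * V + 1)))
  have ha : 0 < a := by positivity
  obtain ⟨S₁, hS₁, hS₁'⟩ := exists_kernel_average_uniform hm hmix hK hh
    (f := fun T t p => (p.2 * p.1 - θ₀ ((t : ℝ) / T)) / V) (fun T t => by fun_prop)
    (fun T => by
      filter_upwards [hB] with ω hω t ht
      have ht' := Finset.mem_Icc.1 ht
      refine hVb _ _ _ (hobs hω (by omega) ht'.2) (hobs hω (by omega) (by omega)) ?_
      have := abs_structural_le hκ₀ hθ₀mem (ht'.1.trans ht'.2) ht'.2
      nlinarith)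
    (fun T t ht => by
      have ht' := Finset.mem_Icc.1 ht
      rw [integral_div]
      simp only [obsPair]
      rw [integral_sub (hobsi T _ (by omega) _ ht'.2 (by omega)) (integrable_const _),
        hcross T t ht]
      simp) ha
  obtain ⟨S₂, hS₂, hS₂'⟩ := exists_kernel_average_uniform hm hmix hK hh
    (f := fun T t p => (p.2 * p.2 - (1 + θ₀ (((t - 1 : ℕ) : ℝ) / T) ^ 2)) / V)
    (fun T t => by fun_prop)
    (fun T => by
      filter_upwards [hB] with ω hω t ht
      have ht' := Finset.mem_Icc.1 ht
      refine hVb _ _ _ (hobs hω (by omega) (by omega)) (hobs hω (by omega) (by omega)) ?_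
      have := abs_structural_le hκ₀ hθ₀mem (ht'.1.trans ht'.2) ((Nat.sub_le t 1).trans ht'.2)
      rw [abs_of_nonneg (by positivity), ← sq_abs]
      gcongr)
    (fun T t ht => by
      have ht' := Finset.mem_Icc.1 ht
      rw [integral_div]
      simp only [obsPair]
      rw [integral_sub (hobsi T _ (by omega) _ (by omega) (by omega)) (integrable_const _),
        hsquare T (t - 1)]
      simp) ha
  obtain ⟨c, hc, hmass⟩ := exists_kernelMass_ge hK hh
  refine ⟨fun T => S₁ T ∪ S₂ T, ?_, ?_⟩
  · refine tendsto_of_tendsto_of_tendsto_of_le_of_le tendsto_const_nhds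
      (h := fun T => μ (S₁ T) + μ (S₂ T)) ?_ (fun T => zero_le) fun T => measure_union_le _ _
    simpa using hS₁.add hS₂
  · filter_upwards [hS₁', hS₂', hmass, eventually_bias_le hκ₀ hθ₀ hθ₀mem hK hh ha,
      eventually_gt_atTop 0] with T h1 h2 h3 h4 hT0 ω hω u hu
    simp only [mem_union, not_or] at hω
    have hu' : u ∈ Icc (0 : ℝ) 1 := ⟨hu.1.le, hu.2.le⟩
    have hhT := hh.pos T
    have hT0' : (0 : ℝ) < T := by exact_mod_cast hT0
    have n1 := h1 ω hω.1 u hu'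
    have n2 := h2 ω hω.2 u hu'
    have n3 := h4 u hu
    have hW0 : 0 < kernelMass K h T u := lt_of_lt_of_le (by positivity) (h3 u hu')
    set W := kernelMass K h T u with hW
    set w := kernelWeight K h T u
    set ψ := binding (θ₀ u)
    set E₁ := ∑ t ∈ Finset.Icc 1 T, w t *
      (((obsPair ε θ₀ T t ω).2 * (obsPair ε θ₀ T t ω).1 - θ₀ ((t : ℝ) / T)) / V)
    set E₂ := ∑ t ∈ Finset.Icc 1 T, w t * (((obsPair ε θ₀ T t ω).2 * (obsPair ε θ₀ T t ω).2 -
      (1 + θ₀ (((t - 1 : ℕ) : ℝ) / T) ^ 2)) / V)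
    set E₃ := ∑ t ∈ Finset.Icc 1 T, w t * (θ₀ ((t : ℝ) / T) -
      ψ * (1 + θ₀ (((t - 1 : ℕ) : ℝ) / T) ^ 2))
    set Nm := ∑ t ∈ Finset.Icc 1 T, obs ε θ₀ T (t - 1) ω * obs ε θ₀ T t ω *
      K ((u - (t : ℝ) / (T : ℝ)) / h T)
    set Dn := ∑ t ∈ Finset.Icc 1 T, obs ε θ₀ T (t - 1) ω ^ 2 * K ((u - (t : ℝ) / (T : ℝ)) / h T)
    have eN : Nm - ψ * Dn = V * E₁ - ψ * (V * E₂) + E₃ := by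
      simp only [Nm, Dn, E₁, E₂, E₃]
      rw [Finset.mul_sum, Finset.mul_sum, Finset.mul_sum, Finset.mul_sum,
        ← Finset.sum_sub_distrib, ← Finset.sum_sub_distrib, ← Finset.sum_add_distrib]
      refine Finset.sum_congr rfl fun t _ => ?_
      simp only [obsPair, w, kernelWeight]
      field_simp
      ring
    -- The mean square of an observation is 1 + θ₀² ≥ 1, so the denominator is at least the kernel
    -- mass up to noise.
    have eD : W + V * E₂ ≤ Dn := by
      simp only [hW, kernelMass, Dn, E₂]
      rw [Finset.mul_sum, ← Finset.sum_add_distrib]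
      refine Finset.sum_le_sum fun t _ => ?_
      have hw0 : 0 ≤ w t := hK.nonneg _
      have e : w t + V * (w t * (((obsPair ε θ₀ T t ω).2 * (obsPair ε θ₀ T t ω).2 -
          (1 + θ₀ (((t - 1 : ℕ) : ℝ) / T) ^ 2)) / V)) =
          obs ε θ₀ T (t - 1) ω ^ 2 * w t - w t * θ₀ (((t - 1 : ℕ) : ℝ) / T) ^ 2 := by
        simp only [obsPair]
        field_simp
        ring
      rw [show kernelWeight K h T u t = w t from rfl, e]
      have : 0 ≤ w t * θ₀ (((t - 1 : ℕ) : ℝ) / T) ^ 2 := by positivity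
      change _ ≤ obs ε θ₀ T (t - 1) ω ^ 2 * w t
      linarith
    have aV : V * a ≤ 1 / 2 := by
      calc V * a ≤ V * (1 / (2 * V)) := by gcongr; exact min_le_left _ _
        _ = 1 / 2 := by field_simp
    have aη : 2 * ((2 * V + 1) * a) ≤ η := by
      calc 2 * ((2 * V + 1) * a) ≤ 2 * ((2 * V + 1) * (η / (2 * (2 * V + 1)))) := by
            gcongr; exact min_le_right _ _
        _ = η := by field_simp
    have hψ : |ψ| ≤ 1 := (abs_binding_le _).trans (by norm_num)
    have hVE₂ : |V * E₂| ≤ V * (a * W) := by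
      rw [abs_mul, abs_of_pos hV]
      gcongr
    have hD : W / 2 ≤ Dn := by
      have := (abs_le.1 hVE₂).1
      nlinarith
    have hD0 : 0 < Dn := by linarith
    have hN : |Nm - ψ * Dn| ≤ (2 * V + 1) * a * W := by
      rw [eN]
      calc |V * E₁ - ψ * (V * E₂) + E₃| ≤ |V * E₁| + |ψ * (V * E₂)| + |E₃| :=
            (abs_add_le _ _).trans (add_le_add (abs_sub _ _) le_rfl)
        _ ≤ V * (a * W) + 1 * (V * (a * W)) + a * W := by
            rw [abs_mul V E₁, abs_of_pos hV, abs_mul ψ]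
            gcongr
        _ = (2 * V + 1) * a * W := by ring
    have e : rhoHat (obs ε θ₀) K h T u ω - ψ = (Nm - ψ * Dn) / Dn := by
      rw [sub_div, mul_div_cancel_right₀ _ hD0.ne']
      rfl
    rw [e, abs_div, abs_of_pos hD0, div_le_iff₀ hD0]
    calc |Nm - ψ * Dn| ≤ (2 * V + 1) * a * W := hN
      _ = 2 * ((2 * V + 1) * a) * (W / 2) := by ring
      _ ≤ η * Dn := by gcongr

end KernelEstimator

/-! ### Inverting the binding function and conclusion -/

/-- The binding function is injective on the parameter space, with a Lipschitz inverse. -/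
theorem abs_sub_le_binding {κ x y : ℝ} (hκ₀ : 0 < κ) (hκ₁ : κ < 1) (hx : x ∈ paramSpace κ)
    (hy : y ∈ paramSpace κ) : |x - y| ≤ 4 / κ * |binding x - binding y| := by
  have hx1 := abs_le_of_mem_paramSpace hx
  have hy1 := abs_le_of_mem_paramSpace hy
  have hxy : |x * y| ≤ 1 - κ := by
    rw [abs_mul]
    nlinarith [abs_nonneg x, abs_nonneg y]
  have hsq : ∀ z : ℝ, |z| ≤ 1 - κ → z ^ 2 ≤ 1 := fun z hz => by
    rw [← sq_abs]
    exact pow_le_one₀ (abs_nonneg _) (by linarith)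
  have e : binding x - binding y = (x - y) * (1 - x * y) / ((1 + x ^ 2) * (1 + y ^ 2)) := by
    rw [binding, binding, div_sub_div _ _ (by positivity) (by positivity)]
    ring
  have h1 : κ ≤ 1 - x * y := by linarith [(abs_le.1 hxy).2]
  have h2 : (1 + x ^ 2) * (1 + y ^ 2) ≤ 4 := by
    nlinarith [hsq x hx1, hsq y hy1, sq_nonneg x, sq_nonneg y]
  have h3 : 0 < (1 + x ^ 2) * (1 + y ^ 2) := by positivity
  rw [e, abs_div, abs_mul, abs_of_pos (hκ₀.trans_le h1), abs_of_pos h3, div_mul_div_comm,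
    le_div_iff₀ (by positivity)]
  nlinarith [mul_le_mul h2 (le_refl κ) hκ₀.le (by norm_num), abs_nonneg (x - y),
    mul_nonneg (abs_nonneg (x - y)) (sub_nonneg.2 h1),
    mul_nonneg (abs_nonneg (x - y)) (mul_nonneg hκ₀.le (sub_nonneg.2 h2))]

/-- If the auxiliary estimators are close to the binding function, then every maximizer of the
indirect inference criterion is close to the true parameter. -/
theorem abs_estimator_sub_le {κ ρ η θ θ' : ℝ} {f : ℝ → ℝ} (hκ₀ : 0 < κ) (hκ₁ : κ < 1)
    (hθ : θ ∈ paramSpace κ) (hρ : |ρ - binding θ| ≤ η)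
    (hf : ∀ x ∈ paramSpace κ, |f x - binding x| ≤ η)
    (hθ' : IsArgmax (fun x => -|ρ - f x|) (paramSpace κ) θ') :
    |θ' - θ| ≤ 16 * η / κ := by
  obtain ⟨hmem, hmax⟩ := hθ'
  have h1 : |ρ - f θ'| ≤ |ρ - f θ| := neg_le_neg_iff.1 (hmax hθ)
  have h2 := abs_le.1 hρ
  have h3 := abs_le.1 (hf θ hθ)
  have h4 := abs_le.1 (hf θ' hmem)
  have h5 : |ρ - f θ| ≤ 2 * η := by rw [abs_le]; constructor <;> linarith
  have h6 := abs_le.1 (h1.trans h5)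
  -- The triangle inequality through f θ' and ρ: η + 2η + η.
  have h7 : |binding θ' - binding θ| ≤ 4 * η := by rw [abs_le]; constructor <;> linarith
  calc |θ' - θ| ≤ 4 / κ * |binding θ' - binding θ| := abs_sub_le_binding hκ₀ hκ₁ hmem hθ
    _ ≤ 4 / κ * (4 * η) := by gcongr
    _ = 16 * η / κ := by ring

theorem exists_isArgmax {κ ρ : ℝ} {f : ℝ → ℝ} (hκ₁ : κ < 1)
    (hf : ContinuousOn f (paramSpace κ)) :
    ∃ θ, IsArgmax (fun x => -|ρ - f x|) (paramSpace κ) θ :=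
  isCompact_Icc.exists_isMaxOn (nonempty_Icc.2 (by linarith))
    (continuousOn_const.sub hf).abs.neg

end LII

theorem corollary2 {Ω : Type*} [MeasurableSpace Ω] (μ : Measure Ω) [IsProbabilityMeasure μ]
    -- the observed errors and the structural function
    (ε : ℤ → Ω → ℝ) (hε : LII.IsWhiteNoise μ ε)
    (κ : ℝ) (hκ₀ : 0 < κ) (hκ₁ : κ < 1)
    (θ₀ : ℝ → ℝ) (hθ₀ : LII.BoundedSecondDeriv θ₀ (Ioo 0 1))
    (hθ₀mem : ∀ u ∈ Ioo (0 : ℝ) 1, θ₀ u ∈ LII.paramSpace κ)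
    -- the trimming of the rescaled time axis
    (δ : ℕ → ℝ) (hδ : ∀ T, 0 < δ T ∧ δ T < 1 / 2)
    -- mixing, kernel and bandwidth
    (m : ℕ → ℕ) (hmix : LII.IsPhiMixing μ (LII.obsPair ε θ₀) m)
    (K : ℝ → ℝ) (r : ℕ) (hK : LII.IsKernel K r)
    (h : ℕ → ℝ) (hh : LII.IsBandwidth h m)
    -- the pseudo-true auxiliary function
    (ρ₀ : ℝ → ℝ) (hρ₀ : LII.IsPseudoTrue μ (LII.obs ε θ₀) K h (LII.paramSpace κ) ρ₀)
    (hρ₀sup : ∃ c < 1, ∀ u ∈ Ioo (0 : ℝ) 1, |ρ₀ u| ≤ c)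
    (hρ₀deriv : LII.BoundedSecondDeriv ρ₀ (Ioo 0 1))
    (hscore : LII.ScoreBounded μ (LII.obs ε θ₀) (LII.paramSpace κ) ρ₀
      (fun T => LII.timeSet (δ T)))
    -- the simulated errors
    (H : ℕ) (hH : 0 < H) (εs : Fin H → ℤ → Ω → ℝ)
    (hεs_law : ∀ j, IdentDistrib (fun ω t => εs j t ω) (fun ω t => ε t ω) μ μ)
    (hεs_indep : iIndepFun (fun j ω t => εs j t ω) μ)
    -- the estimator
    (θhat : ℕ → ℝ → Ω → ℝ)
    (hθhat : LII.IsLIIEstimator (LII.obs ε θ₀) K h εs (LII.paramSpace κ)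
      (fun T => LII.timeSet (δ T)) θhat) :
    LII.IsLittleOpOne μ
      (fun T ω => ⨆ u ∈ LII.timeSet (δ T), ENNReal.ofReal |θhat T u ω - θ₀ u|) := by
  obtain ⟨B, hB1, hB⟩ := LII.exists_noise_bound hε hκ₀ hκ₁ hθ₀mem hδ
    (by
      obtain ⟨M₀, -, hmem, -⟩ := hρ₀ (1 / 2) (by constructor <;> norm_num)
      exact hmem) hscore
  intro a ha
  -- The tolerance κa/16 becomes exactly a in the bound 16η/κ.
  obtain ⟨S₁, hS₁, hS₁'⟩ := LII.exists_rhoSim_close hε hκ₀ hκ₁ hθ₀mem hB1 hB hmix.tendsto_zero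
    hH hεs_law (by positivity : 0 < κ * a / 16)
  obtain ⟨S₂, hS₂, hS₂'⟩ := LII.exists_rhoHat_close hε hκ₀ hθ₀ hθ₀mem hB1 hB hmix hK hh
    (by positivity : 0 < κ * a / 16)
  have hlim : Tendsto (fun T => μ (S₁ T) + μ (S₂ T)) atTop (𝓝 0) := by
    simpa using hS₁.add hS₂
  refine tendsto_of_tendsto_of_tendsto_of_le_of_le' tendsto_const_nhds hlim
    (Eventually.of_forall fun T => zero_le) ?_
  filter_upwards [hS₂', eventually_ge_atTop 1] with T hT hT1
  refine (measure_mono fun ω hω => ?_).trans (measure_union_le (S₁ T) (S₂ T))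
  by_contra hcon
  simp only [mem_union, not_or] at hcon
  refine not_le.2 hω (iSup₂_le fun u hu => ENNReal.ofReal_le_ofReal ?_)
  have hu01 : u ∈ Ioo (0 : ℝ) 1 :=
    ⟨(hδ T).1.trans_le hu.1, hu.2.trans_lt (by linarith [(hδ T).1])⟩
  -- Off the exceptional sets the criterion is continuous on a compact set, so a maximizer exists
  -- and the estimator is one.
  obtain ⟨hcont, hclose⟩ := hS₁' T hT1 ω hcon.1
  have hmax := hθhat T u hu ω (LII.exists_isArgmax hκ₁ hcont)
  refine (LII.abs_estimator_sub_le hκ₀ hκ₁ (hθ₀mem u hu01) (hT ω hcon.2 u hu01) hclose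
    hmax).trans_eq ?_
  field_simp
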